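/- Let $d\in\mathbb N$, $\hbar>0$, $\beta>0$, $h=2\pi\hbar$, and let $H=\frac{|p|^2+|x|^2}{2}=\frac{-\hbar^2\Delta+|x|^2}{2}$, $p=-i\hbar\nabla$, be the harmonic oscillator on $L^2(\mathbb R^d)$ (with its maximal domain). For a bounded operator $T$ on $L^2(\mathbb R^d)$ let $\nabla_\hbar T$ be its quantum gradient, with the $2d$ components $[\partial_{x_j},T]$ and $[\frac{x_j}{i\hbar},T]$, $1\le j\le d$. We say that $\nabla_\hbar T$ is bounded if $T$ preserves the domains of the operators $\partial_{x_j}$ and $x_j$ and the commutators, defined there, extend to bounded operators $K_1,\dots,K_{2d}$ on $L^2(\mathbb R^d)$; then $\|\nabla_\hbar T\|_{\mathcal L^\infty}$ denotes the operator norm of $(K_1,\dots,K_{2d}):L^2(\mathbb R^d)\to L^2(\mathbb R^d)^{2d}$, that is, the norm of $\big(\sum_k K_k^*K_k\big)^{1/2}$. (i) The number $Z_\beta=h^d\,\mathrm{Tr}(e^{-\beta H})$ is positive and finite, and the Boltzmann state $g_\beta=Z_\beta^{-1}e^{-\beta H}$ has a bounded quantum gradient with $$\|\nabla_\hbar g_\beta\|_{\mathcal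 L^\infty}\le\frac{2}{Z_\beta}\max\big(\sqrt\beta,\ \beta\sqrt\hbar\big).$$ (ii) Let $N\ge1$ be an integer and $\mu\in\mathbb R$ (in particular, $\mu$ may be the chemical potential for which the state below satisfies $h^d\,\mathrm{Tr}(\rho_\beta)=1$), and let $\lambda=Nh^d$ and $Z_\mu=\lambda e^{-\beta\mu}$. Then the Fermi–Dirac state $\rho_\beta=\lambda^{-1}\big(1+e^{\beta(H-\mu)}\big)^{-1}$ has a bounded quantum gradient with $$\|\nabla_\hbar\rho_\beta\|_{\mathcal L^\infty}\le\frac{2}{Z_\mu}\max\big(\sqrt\beta,\ \beta\sqrt\hbar\big).$$ -/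

import Mathlib

open MeasureTheory
open scoped SchwartzMap ENNReal LineDeriv Laplacian

noncomputable section

namespace Thermal

/-- The configuration space `ℝᵈ` with its Euclidean norm. -/
abbrev Space (d : ℕ) : Type := EuclideanSpace ℝ (Fin d)

/-- The one-particle Hilbert space `L²(ℝᵈ; ℂ)`, for the Lebesgue measure. -/
abbrev L2 (d : ℕ) : Type := Lp ℂ 2 (volume : Measure (Space d))

/-- The embedding of `L²(ℝᵈ)` into the tempered distributions. -/
def toDist (d : ℕ) : L2 d →ₗ[ℂ] 𝓢'(Space d, ℂ) :=
  (Lp.toTemperedDistributionCLM ℂ (volume : Measure (Space d)) 2).toLinearMap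

theorem toDist_injective (d : ℕ) : Function.Injective (toDist d) :=
  LinearMap.ker_eq_bot.mp
    (Lp.ker_toTemperedDistributionCLM_eq_bot (E := Space d) (F := ℂ) (μ := volume) (p := 2))

/-- The unbounded operator on `L²(ℝᵈ)` given by an operator `D` on tempered distributions, with
its maximal domain: `φ` lies in the domain iff the distribution `D φ` is a function of `L²(ℝᵈ)`,
and the value at `φ` is that function. -/
def maximalOperator {d : ℕ} (D : 𝓢'(Space d, ℂ) →L[ℂ] 𝓢'(Space d, ℂ)) : L2 d →ₗ.[ℂ] L2 d where
  domain := (LinearMap.range (toDist d)).comap (D.toLinearMap ∘ₗ toDist d)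
  toFun := (LinearEquiv.ofInjective (toDist d) (toDist_injective d)).symm.toLinearMap ∘ₗ
    (D.toLinearMap ∘ₗ toDist d).restrict (fun _ h => h)

/-- The defining property of `maximalOperator`. -/
theorem mem_graph_maximalOperator {d : ℕ} (D : 𝓢'(Space d, ℂ) →L[ℂ] 𝓢'(Space d, ℂ))
    (φ ψ : L2 d) : (φ, ψ) ∈ (maximalOperator D).graph ↔ D (toDist d φ) = toDist d ψ := by
  have key : ∀ χ : (maximalOperator D).domain,
      toDist d (maximalOperator D χ) = D (toDist d χ) := fun χ =>
    congrArg Subtype.val ((LinearEquiv.ofInjective (toDist d) (toDist_injective d)).apply_symm_apply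
      ⟨D (toDist d χ), χ.2⟩)
  rw [LinearPMap.mem_graph_iff]
  constructor
  · rintro ⟨χ, h1, h2⟩
    simp only at h1 h2
    rw [← h1, ← h2, key]
  · intro h
    refine ⟨⟨φ, ψ, h.symm⟩, rfl, toDist_injective d ?_⟩
    rw [key]
    exact h

/-- The partial derivative `∂ⱼ` on `L²(ℝᵈ)`, i.e. the `j`-th component of `∇`. -/
def partialDeriv (d : ℕ) (j : Fin d) : L2 d →ₗ.[ℂ] L2 d :=
  maximalOperator (LineDeriv.lineDerivOpCLM ℂ 𝓢'(Space d, ℂ) (EuclideanSpace.single j (1 : ℝ)))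

/-- The operator `xⱼ / (iħ)` of multiplication on `L²(ℝᵈ)`. -/
def positionOver (d : ℕ) (ħ : ℝ) (j : Fin d) : L2 d →ₗ.[ℂ] L2 d :=
  maximalOperator (TemperedDistribution.smulLeftCLM ℂ
    (fun x : Space d => (x j : ℂ) / (Complex.I * (ħ : ℂ))))

/-- The harmonic oscillator `H = (|p|² + |x|²) / 2 = (-ħ² Δ + |x|²) / 2` on `L²(ℝᵈ)`, with
`p = -iħ∇`. -/
def hamiltonian (d : ℕ) (ħ : ℝ) : L2 d →ₗ.[ℂ] L2 d :=
  maximalOperator ((1 / 2 : ℂ) •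
    (-((ħ : ℂ) ^ 2 • LineDeriv.laplacianCLM ℂ (Space d) 𝓢'(Space d, ℂ)) +
      TemperedDistribution.smulLeftCLM ℂ (fun x : Space d => ((‖x‖ ^ 2 : ℝ) : ℂ))))

section Hilbert

variable {𝓗 : Type*} [NormedAddCommGroup 𝓗] [InnerProductSpace ℂ 𝓗]

/-- The eigenspace `{φ ∈ dom A | A φ = E φ}` of an unbounded operator. -/
def eigenspace (A : 𝓗 →ₗ.[ℂ] 𝓗) (E : ℝ) : Submodule ℂ 𝓗 :=
  A.graph.comap (LinearMap.prod LinearMap.id ((E : ℂ) • LinearMap.id))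

variable [CompleteSpace 𝓗]

/-- The operator `f(A)`, for `A` self-adjoint with discrete spectrum (as the harmonic oscillator)
and `f` vanishing at infinity: `f(A) = ∑ f(E) P_E`, a sum over the eigenvalues `E` of `A` that
converges in operator norm, `P_E` being the orthogonal projection onto the eigenspace of `E`
(which is closed since `A` is; `P_E = 0` if `E` is not an eigenvalue). -/
def functionOf (A : 𝓗 →ₗ.[ℂ] 𝓗) (f : ℝ → ℝ) : 𝓗 →L[ℂ] 𝓗 :=
  ∑' E : ℝ, (f E : ℂ) • (eigenspace A E).topologicalClosure.starProjection

/-- The trace `∑ᵢ ⟨bᵢ, T bᵢ⟩ ∈ [0, ∞]` of a nonnegative bounded operator `T`, for a Hilbert basis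
`b` (the sum does not depend on it). -/
def trace (T : 𝓗 →L[ℂ] 𝓗) : ℝ≥0∞ :=
  ∑' i, ENNReal.ofReal
    (inner ℂ ((exists_hilbertBasis ℂ 𝓗).choose_spec.choose i)
      (T ((exists_hilbertBasis ℂ 𝓗).choose_spec.choose i))).re

/-- The bounded operator `K` is the commutator `[A, T] = A T - T A` of an unbounded operator `A`
with a bounded operator `T`: `T` preserves the domain of `A`, and `K = A T - T A` there. (If the
domain of `A` is dense, this determines `K`.) -/
def IsCommutator (A : 𝓗 →ₗ.[ℂ] 𝓗) (T K : 𝓗 →L[ℂ] 𝓗) : Prop :=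
  ∀ φ : A.domain, ∃ h : T φ ∈ A.domain, K φ = A ⟨T φ, h⟩ - T (A φ)

end Hilbert

/-- `e^{-βH}`. -/
def gibbs (d : ℕ) (ħ β : ℝ) : L2 d →L[ℂ] L2 d :=
  functionOf (hamiltonian d ħ) (fun E => Real.exp (-β * E))

/-- `Z_β = hᵈ Tr(e^{-βH})` with `h = 2πħ`. It is `0` if the trace is infinite. -/
def partitionFunction (d : ℕ) (ħ β : ℝ) : ℝ :=
  (2 * Real.pi * ħ) ^ d * (trace (gibbs d ħ β)).toReal

/-- The Boltzmann state `g_β = Z_β⁻¹ e^{-βH}`. -/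
def boltzmann (d : ℕ) (ħ β : ℝ) : L2 d →L[ℂ] L2 d :=
  ((partitionFunction d ħ β)⁻¹ : ℂ) • gibbs d ħ β

/-- `λ = N hᵈ` with `h = 2πħ`. -/
def density (d N : ℕ) (ħ : ℝ) : ℝ := N * (2 * Real.pi * ħ) ^ d

/-- The Fermi-Dirac state `ρ_β = λ⁻¹ (1 + e^{β(H-μ)})⁻¹`. -/
def fermiDirac (d N : ℕ) (ħ β μ : ℝ) : L2 d →L[ℂ] L2 d :=
  ((density d N ħ)⁻¹ : ℂ) •
    functionOf (hamiltonian d ħ) (fun E => (1 + Real.exp (β * (E - μ)))⁻¹)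

/-- `Z_μ = λ e^{-βμ}`. -/
def inverseFugacity (d N : ℕ) (ħ β μ : ℝ) : ℝ := density d N ħ * Real.exp (-β * μ)

/-- The values of a full quantum gradient: `2d` components in `L²(ℝᵈ)`, with the Hilbert norm
`(∑ₖ ‖φₖ‖²)^{1/2}`. -/
abbrev GradL2 (d : ℕ) : Type := PiLp 2 (fun _ : Fin d ⊕ Fin d => L2 d)

/-- The bounded operator `K : L²(ℝᵈ) → L²(ℝᵈ)²ᵈ` is the full quantum gradient of `T`: its components
are the commutators `[∂ⱼ, T]` and `[xⱼ / (iħ), T]`, `1 ≤ j ≤ d`. As `|K| = (∑ₖ Kₖ* Kₖ)^{1/2}`, the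
operator norm of the gradient is `‖K‖`. -/
def IsQuantumGradient {d : ℕ} (ħ : ℝ) (T : L2 d →L[ℂ] L2 d) (K : L2 d →L[ℂ] GradL2 d) : Prop :=
  (∀ j : Fin d, IsCommutator (partialDeriv d j) T
    (PiLp.proj 2 (fun _ : Fin d ⊕ Fin d => L2 d) (Sum.inl j) ∘L K)) ∧
  (∀ j : Fin d, IsCommutator (positionOver d ħ j) T
    (PiLp.proj 2 (fun _ : Fin d ⊕ Fin d => L2 d) (Sum.inr j) ∘L K))

end Thermal

end

noncomputable section

namespace Thermal

/-! The Hermite functions hₙ, built from the Gaussian exp(-|x|²/(2ħ)) by creation operators, form a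
Hilbert basis of eigenvectors of H, with energies Eₙ = ħ(|n| + d/2). Hence T = F(H) is diagonal.
Since ∂ⱼ = (2ħ)^{-1/2}(aⱼ - aⱼ*) and xⱼ/(iħ) = -i(2ħ)^{-1/2}(aⱼ + aⱼ*), both commutators with T are
combinations of the same two shifts n ↦ n ∓ eⱼ, weighted by increments of F. When their squares are
added, the parallelogram law removes the cross terms, so ∑ₖ Kₖ*Kₖ is diagonal with entries, at E =
Eₙ, ħ⁻¹ ((|n| + d)(F(E) - F(E+ħ))² + |n| (F(E-ħ) - F(E))²).

Suppose the increments of F are at most C times those of e^{-βE}. As ħ(|n| + d) ≤ 2E, and ħ|n| ≤ 2(E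
- ħ) if n ≠ 0, the inequality k e^{-v}(1 - e^{-u})² ≤ u for uk ≤ v bounds each of the two terms,
before the factor ħ⁻¹, by C²βħ (`sum_ladder_weights_le`). So ‖K‖ ≤ C√(2β) ≤ 2C√β, and the first
entry of the maximum suffices. The Boltzmann weight has C = 1. The Fermi–Dirac weight has C =
e^{βμ}, because 1/(1+y) varies less than 1/y at y = e^{β(E-μ)}.

The unbounded operators enter through their closed graphs (`isCommutator_of_hasSum_rankOne`): the
exponential decay of F makes the rank-one series of T and of its commutators converge in norm. The
exact count of coefficients is `enorm_commutators_sq_le`. -/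

theorem enorm_sq_eq_ofReal {V : Type*} [SeminormedAddCommGroup V] (v : V) :
    ‖v‖ₑ ^ 2 = ENNReal.ofReal (‖v‖ ^ 2) := by
  rw [ENNReal.ofReal_pow (norm_nonneg _), ofReal_norm]

/-! ### Operators diagonal in a Hilbert basis: commutators, functional calculus, trace -/

section Hilbert

variable {𝓗 : Type*} [NormedAddCommGroup 𝓗] [InnerProductSpace ℂ 𝓗]
variable {ι : Type*}

open InnerProductSpace

/-- A diagonal operator preserves the domain of a closed operator `A` that is skew with respect to
the diagonalizing vectors, and the commutator is given by the formal series. -/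
theorem isCommutator_of_hasSum_rankOne (A : 𝓗 →ₗ.[ℂ] 𝓗) (hA : IsClosed (A.graph : Set (𝓗 × 𝓗)))
    {h Dh : ι → 𝓗} (hgraph : ∀ n, (h n, Dh n) ∈ A.graph)
    (hskew : ∀ n φ ψ, (φ, ψ) ∈ A.graph → inner ℂ (h n) ψ = -inner ℂ (Dh n) φ)
    {t : ι → ℂ} {T K : 𝓗 →L[ℂ] 𝓗} (hT : HasSum (fun n => t n • rankOne ℂ (h n) (h n)) T)
    (hK : HasSum (fun n => t n • (rankOne ℂ (Dh n) (h n) + rankOne ℂ (h n) (Dh n))) K) :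
    IsCommutator A T K := by
  intro φ
  have hφ : ((φ : 𝓗), A φ) ∈ A.graph := A.mem_graph φ
  have h1 : HasSum (fun n => t n • inner ℂ (h n) (φ : 𝓗) • h n) (T φ) := by
    simpa using hT.mapL (ContinuousLinearMap.apply ℂ 𝓗 (φ : 𝓗))
  have h2 : HasSum (fun n => t n • inner ℂ (h n) (A φ) • h n) (T (A φ)) := by
    simpa using hT.mapL (ContinuousLinearMap.apply ℂ 𝓗 (A φ))
  have h3 : HasSum (fun n => t n • (inner ℂ (h n) (φ : 𝓗) • Dh n + inner ℂ (Dh n) (φ : 𝓗) • h n))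
      (K φ) := by
    simpa using hK.mapL (ContinuousLinearMap.apply ℂ 𝓗 (φ : 𝓗))
  -- Skewness turns the coefficients of T(Aφ) into -⟨Dh n, φ⟩, which cancels half of Kφ. What
  -- remains is A applied termwise to the series of Tφ, so closedness of the graph gives both Tφ ∈
  -- dom A and the value there.
  have h4 : HasSum (fun n => t n • inner ℂ (h n) (φ : 𝓗) • Dh n) (K φ + T (A φ)) := by
    refine (h3.add h2).congr_fun fun n => ?_
    rw [hskew n _ _ hφ]
    module
  have h5 : (T φ, K φ + T (A φ)) ∈ A.graph := by
    refine hA.mem_of_tendsto (h1.prodMk h4) (Filter.Eventually.of_forall fun s => ?_)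
    refine sum_mem fun n _ => ?_
    exact A.graph.smul_mem (t n) (A.graph.smul_mem (inner ℂ (h n) (φ : 𝓗)) (hgraph n))
  rw [LinearPMap.mem_graph_iff] at h5
  obtain ⟨y, hy1, hy2⟩ := h5
  simp only at hy1 hy2
  have hy : T φ ∈ A.domain := hy1 ▸ y.2
  refine ⟨hy, ?_⟩
  have : y = ⟨T φ, hy⟩ := Subtype.ext hy1
  rw [← this, hy2, add_sub_cancel_right]

/-- Parseval's identity in `[0, ∞]`. -/
theorem _root_.HilbertBasis.tsum_enorm_inner_sq (b : HilbertBasis ι ℂ 𝓗) (φ : 𝓗) :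
    ∑' i, ‖inner ℂ (b i) φ‖ₑ ^ 2 = ‖φ‖ₑ ^ 2 := by
  have h := b.hasSum_inner_mul_inner φ φ
  have h' := Complex.hasSum_re h
  have e : ∀ i, (inner ℂ φ (b i) * inner ℂ (b i) φ).re = ‖inner ℂ (b i) φ‖ ^ 2 := fun i => by
    rw [← inner_conj_symm φ (b i), ← Complex.normSq_eq_conj_mul_self, Complex.ofReal_re,
      Complex.normSq_eq_norm_sq]
  have e2 : (inner ℂ φ φ).re = ‖φ‖ ^ 2 := by
    rw [inner_self_eq_norm_sq_to_K]; norm_cast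
  simp only [e, e2] at h'
  simp only [enorm_sq_eq_ofReal]
  rw [← h'.tsum_eq, ENNReal.ofReal_tsum_of_nonneg (fun _ => by positivity) h'.summable]

variable [CompleteSpace 𝓗]

/-- If a Hilbert basis consists of eigenvectors of a symmetric operator, the functional calculus is
diagonal in that basis. -/
theorem hasSum_functionOf (A : 𝓗 →ₗ.[ℂ] 𝓗) (b : HilbertBasis ι ℂ 𝓗) (E : ι → ℝ)
    (hgraph : ∀ n, (b n, (E n : ℂ) • b n) ∈ A.graph)
    (hsymm : ∀ n φ ψ, (φ, ψ) ∈ A.graph → inner ℂ (b n) ψ = (E n : ℂ) * inner ℂ (b n) φ)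
    (f : ℝ → ℝ) (hf : Summable fun n => |f (E n)|) :
    HasSum (fun n => (f (E n) : ℂ) • rankOne ℂ (b n) (b n)) (functionOf A f) := by
  have hn : ∀ n, ‖b n‖ = 1 := b.orthonormal.1
  have hs : Summable (fun n => (f (E n) : ℂ) • rankOne ℂ (b n) (b n)) := by
    refine Summable.of_norm ?_
    simpa [norm_smul, hn] using hf
  -- `functionOf` sums over all real e. The basis vectors of energy e resum to the spectral
  -- projection, which fixes them and, by symmetry of A, kills the other basis vectors.
  have hfib : ∀ e : ℝ, ∑' n : E ⁻¹' {e}, (f (E n) : ℂ) • rankOne ℂ (b n) (b n) =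
      (f e : ℂ) • (eigenspace A e).topologicalClosure.starProjection := by
    intro e
    have hs' : Summable fun n : E ⁻¹' {e} => (f (E n) : ℂ) • rankOne ℂ (b n) (b n) :=
      hs.subtype _
    refine ContinuousLinearMap.ext_on
      (Submodule.dense_iff_topologicalClosure_eq_top.mpr b.dense_span) ?_
    rintro _ ⟨m, rfl⟩
    have hap := (hs'.hasSum.mapL (ContinuousLinearMap.apply ℂ 𝓗 (b m)))
    simp only [ContinuousLinearMap.apply_apply, smul_apply,
      rankOne_apply] at hap
    rw [← hap.tsum_eq, smul_apply]
    by_cases hm : E m = e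
    · have hproj : (eigenspace A e).topologicalClosure.starProjection (b m) = b m := by
        rw [Submodule.starProjection_eq_self_iff]
        refine Submodule.le_topologicalClosure _ ?_
        subst hm
        exact hgraph m
      rw [hproj, tsum_eq_single ⟨m, hm⟩]
      · simp [b.orthonormal.1, hm, inner_self_eq_norm_sq_to_K]
      · intro n hnm
        rw [b.orthonormal.2 (fun h => hnm (Subtype.ext h)), zero_smul, smul_zero]
    · have hproj : (eigenspace A e).topologicalClosure.starProjection (b m) = 0 := by
        rw [Submodule.starProjection_apply_eq_zero_iff, Submodule.orthogonal_closure,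
          Submodule.mem_orthogonal']
        intro φ hφ
        have := hsymm m φ _ hφ
        simp only [LinearMap.smul_apply, LinearMap.id_apply, inner_smul_right] at this
        have h0 : ((e : ℂ) - E m) * inner ℂ (b m) φ = 0 := by rw [sub_mul, this, sub_self]
        rcases mul_eq_zero.mp h0 with h | h
        · exact absurd (by exact_mod_cast (sub_eq_zero.mp h).symm) hm
        · exact h
      rw [hproj, smul_zero]
      convert tsum_zero with n
      have : (n : ι) ≠ m := fun h => hm (by rw [← h]; exact n.2)
      rw [b.orthonormal.2 this, zero_smul, smul_zero]
  have := hs.hasSum.tsum_fiberwise E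
  simp only [hfib] at this
  rw [functionOf, this.tsum_eq]
  exact hs.hasSum

/-- The trace of a nonnegative diagonal operator is the sum of its diagonal entries. -/
theorem trace_eq_of_hasSum_rankOne (b : HilbertBasis ι ℂ 𝓗) {t : ι → ℝ} (ht : ∀ n, 0 ≤ t n)
    {T : 𝓗 →L[ℂ] 𝓗} (hT : HasSum (fun n => (t n : ℂ) • rankOne ℂ (b n) (b n)) T) :
    trace T = ∑' n, ENNReal.ofReal (t n) := by
  set b' := (exists_hilbertBasis ℂ 𝓗).choose_spec.choose with hb'
  have h1 : ∀ i, ENNReal.ofReal (inner ℂ (b' i) (T (b' i))).re =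
      ∑' n, ENNReal.ofReal (t n) * ‖inner ℂ (b n) (b' i)‖ₑ ^ 2 := by
    intro i
    have h := (hT.mapL (ContinuousLinearMap.apply ℂ 𝓗 (b' i))).mapL (innerSL ℂ (b' i))
    have h' := Complex.hasSum_re h
    simp only [ContinuousLinearMap.apply_apply, smul_apply,
      rankOne_apply, innerSL_apply_apply, inner_smul_right] at h'
    have e : ∀ n, ((t n : ℂ) * (inner ℂ (b n) (b' i) * inner ℂ (b' i) (b n))).re =
        t n * ‖inner ℂ (b n) (b' i)‖ ^ 2 := fun n => by
      rw [← inner_conj_symm (b' i) (b n), Complex.mul_conj, Complex.normSq_eq_norm_sq]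
      norm_cast
    simp only [e] at h'
    rw [← h'.tsum_eq, ENNReal.ofReal_tsum_of_nonneg (fun n => mul_nonneg (ht n) (by positivity))
      h'.summable]
    refine tsum_congr fun n => ?_
    rw [ENNReal.ofReal_mul (ht n), ENNReal.ofReal_pow (norm_nonneg _), ofReal_norm]
  unfold trace
  rw [← hb']
  simp only [h1]
  -- All terms lie in [0, ∞], so the sums may be exchanged; Parseval for b' at each b n then gives
  -- the factor 1.
  rw [ENNReal.tsum_comm]
  refine tsum_congr fun n => ?_
  rw [ENNReal.tsum_mul_left]
  have : ∀ i, ‖inner ℂ (b n) (b' i)‖ₑ = ‖inner ℂ (b' i) (b n)‖ₑ := fun i => by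
    rw [← ofReal_norm, ← ofReal_norm, norm_inner_symm]
  simp only [this, b'.tsum_enorm_inner_sq]
  rw [← ofReal_norm, b.orthonormal.1]
  simp

end Hilbert

end Thermal

end

noncomputable section

namespace Thermal

/-! ### The Gaussian as a Schwartz function -/

section Gaussian

variable {V : Type*} [NormedAddCommGroup V] [InnerProductSpace ℝ V]

open scoped ContDiff

section Decay

open scoped Nat

theorem norm_iteratedFDeriv_exp_neg_mul (a : ℝ) (i : ℕ) (t : ℝ) :
    ‖iteratedFDeriv ℝ i (fun t : ℝ => Real.exp (-a * t)) t‖ = |a| ^ i * Real.exp (-a * t) := by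
  rw [norm_iteratedFDeriv_eq_norm_iteratedDeriv, iteratedDeriv_exp_const_mul]
  simp

/-- From 1 + r ≤ 2(1 + r²), and a single term of the exponential series at a(1 + r²). -/
theorem one_add_pow_mul_exp_neg_le {a : ℝ} (ha : 0 < a) (m : ℕ) {r : ℝ} (hr : 0 ≤ r) :
    (1 + r) ^ m * Real.exp (-a * r ^ 2) ≤ 2 ^ m * (m ! * Real.exp a / a ^ m) := by
  have h1 := Real.pow_div_factorial_le_exp (a * (1 + r ^ 2)) (by positivity) m
  have h2 : (1 + r) ^ m ≤ 2 ^ m * (1 + r ^ 2) ^ m := by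
    rw [← mul_pow]
    gcongr
    nlinarith [sq_nonneg (r - 1)]
  rw [div_le_iff₀ (by positivity), mul_pow, mul_add, mul_one, Real.exp_add] at h1
  calc (1 + r) ^ m * Real.exp (-a * r ^ 2)
      ≤ 2 ^ m * (1 + r ^ 2) ^ m * Real.exp (-a * r ^ 2) := by gcongr
    _ = 2 ^ m * ((a ^ m * (1 + r ^ 2) ^ m) / a ^ m * Real.exp (-a * r ^ 2)) := by
        field_simp
    _ ≤ 2 ^ m * ((Real.exp a * Real.exp (a * r ^ 2) * m !) / a ^ m * Real.exp (-a * r ^ 2)) := by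
        gcongr
    _ = 2 ^ m * (m ! * Real.exp a / a ^ m) * (Real.exp (a * r ^ 2) * Real.exp (-a * r ^ 2)) := by
        ring
    _ = _ := by rw [← Real.exp_add]; simp

/-- The derivatives of ‖x‖² grow polynomially and those of exp(-a·) keep the Gaussian factor; the
Faà di Bruno estimate combines them. -/
theorem exists_pow_mul_iteratedFDeriv_gaussian_le {a : ℝ} (ha : 0 < a) (k n : ℕ) :
    ∃ C : ℝ, ∀ x : V,
      ‖x‖ ^ k * ‖iteratedFDeriv ℝ n (fun x : V => Real.exp (-a * ‖x‖ ^ 2)) x‖ ≤ C := by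
  obtain ⟨l, C, hC, hg⟩ :=
    (Function.hasTemperateGrowth_norm_sq (H := V)).norm_iteratedFDeriv_le_uniform n
  refine ⟨n ! * (1 + a) ^ n * (C + 1) ^ n *
    (2 ^ (k + l * n) * ((k + l * n)! * Real.exp a / a ^ (k + l * n))), fun x => ?_⟩
  have hgrowth (N : ℕ) (hN₁ : 1 ≤ N) (hN₂ : N ≤ n) :
      ‖iteratedFDeriv ℝ N (fun x : V => ‖x‖ ^ 2) x‖ ≤ ((C + 1) * (1 + ‖x‖) ^ l) ^ N := by
    refine (hg N hN₂ x).trans ?_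
    -- With C + 1 in place of C the base is at least 1, hence at most its N-th power.
    refine le_trans ?_ (le_self_pow₀ ?_ (by lia))
    · gcongr; linarith
    · exact one_le_mul_of_one_le_of_one_le (by linarith) (one_le_pow₀ (by simp))
  have hexp : ∀ i ≤ n, ‖iteratedFDeriv ℝ i (fun t : ℝ => Real.exp (-a * t)) (‖x‖ ^ 2)‖ ≤
      (1 + a) ^ n * Real.exp (-a * ‖x‖ ^ 2) := by
    intro i hi
    rw [norm_iteratedFDeriv_exp_neg_mul]
    gcongr
    calc |a| ^ i ≤ (1 + a) ^ i := by
          gcongr; rw [abs_of_pos ha]; linarith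
      _ ≤ (1 + a) ^ n := pow_le_pow_right₀ (by linarith) hi
  have := norm_iteratedFDeriv_comp_le (N := ∞) (g := fun t : ℝ => Real.exp (-a * t))
    (f := fun x : V => ‖x‖ ^ 2) (n := n) (by fun_prop) (contDiff_norm_sq ℝ) (mod_cast le_top) x
    hexp hgrowth
  have hcomp : (fun t : ℝ => Real.exp (-a * t)) ∘ (fun x : V => ‖x‖ ^ 2) =
    fun x : V => Real.exp (-a * ‖x‖ ^ 2) := rfl
  rw [hcomp] at this
  calc _ ≤ (1 + ‖x‖) ^ k * (n ! * ((1 + a) ^ n * Real.exp (-a * ‖x‖ ^ 2)) *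
        ((C + 1) * (1 + ‖x‖) ^ l) ^ n) := by
        gcongr
        linarith
    _ = n ! * (1 + a) ^ n * (C + 1) ^ n *
        ((1 + ‖x‖) ^ (k + l * n) * Real.exp (-a * ‖x‖ ^ 2)) := by
        rw [mul_pow, pow_add, ← pow_mul]; ring
    _ ≤ _ := by
        exact mul_le_mul_of_nonneg_left (one_add_pow_mul_exp_neg_le ha _ (norm_nonneg x))
          (by positivity)

end Decay

/-- The Gaussian `x ↦ exp (-a ‖x‖ ^ 2)` as a Schwartz function. -/
def gaussian (V : Type*) [NormedAddCommGroup V] [InnerProductSpace ℝ V] (a : ℝ) (ha : 0 < a) :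
    𝓢(V, ℂ) where
  toFun x := (Real.exp (-a * ‖x‖ ^ 2) : ℂ)
  smooth' := by
    have : ContDiff ℝ ∞ (fun x : V => Real.exp (-a * ‖x‖ ^ 2)) :=
      (contDiff_const.mul (contDiff_norm_sq ℝ)).exp
    exact Complex.ofRealCLM.contDiff.comp this
  decay' k n := by
    obtain ⟨C, hC⟩ := exists_pow_mul_iteratedFDeriv_gaussian_le (V := V) ha k n
    refine ⟨C, fun x => ?_⟩
    have : ‖iteratedFDeriv ℝ n (fun x : V => ((Real.exp (-a * ‖x‖ ^ 2) : ℝ) : ℂ)) x‖ =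
        ‖iteratedFDeriv ℝ n (fun x : V => Real.exp (-a * ‖x‖ ^ 2)) x‖ :=
      Complex.ofRealLI.norm_iteratedFDeriv_comp_left (n := ∞)
        (((contDiff_const.mul (contDiff_norm_sq ℝ)).exp).contDiffAt) (mod_cast le_top)
    rw [this]
    exact hC x

@[simp]
theorem gaussian_apply (a : ℝ) (ha : 0 < a) (x : V) :
    gaussian V a ha x = (Real.exp (-a * ‖x‖ ^ 2) : ℂ) := rfl

/-! ### Totality of polynomials times a Gaussian -/

section Completeness

variable [FiniteDimensional ℝ V] [MeasurableSpace V] [BorelSpace V]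

open FourierTransform

/-- A Gaussian times a square-integrable function has exponential moments. -/
theorem integrable_exp_inner_mul_gaussian_mul {a : ℝ} (ha : 0 < a) {φ : V → ℂ}
    (hφ : MemLp φ 2 volume) (v : V) :
    Integrable (fun x => Real.exp |inner ℝ x v| * ‖gaussian V a ha x * φ x‖) volume := by
  have h1 : MemLp (fun x : V => Real.exp |inner ℝ x v| * ‖gaussian V a ha x‖) 2 volume := by
    -- Completing the square, |⟨x, v⟩| ≤ ‖v‖²/(2a) + (a/2)‖x‖², so the exponential uses up only half
    -- of the Gaussian.
    refine MemLp.of_le_mul (c := Real.exp (‖v‖ ^ 2 / (2 * a)))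
      ((gaussian V (a / 2) (by positivity)).memLp 2 volume) ?_ ?_
    · refine Continuous.aestronglyMeasurable ?_
      exact (Real.continuous_exp.comp (by fun_prop)).mul (gaussian V a ha).continuous.norm
    · refine Filter.Eventually.of_forall fun x => ?_
      simp only [gaussian_apply, norm_mul, Complex.norm_real, Real.norm_eq_abs,
        Real.abs_exp]
      rw [← Real.exp_add, ← Real.exp_add]
      refine Real.exp_le_exp.mpr ?_
      have h2 : |inner ℝ x v| ≤ ‖x‖ * ‖v‖ := abs_real_inner_le_norm x v
      have h3 : ‖x‖ * ‖v‖ ≤ ‖v‖ ^ 2 / (2 * a) + a / 2 * ‖x‖ ^ 2 := by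
        have : 0 ≤ (a * ‖x‖ - ‖v‖) ^ 2 / (2 * a) := by positivity
        have e : (a * ‖x‖ - ‖v‖) ^ 2 / (2 * a) =
            ‖v‖ ^ 2 / (2 * a) + a / 2 * ‖x‖ ^ 2 - ‖x‖ * ‖v‖ := by
          field_simp
          ring
        linarith
      linarith
  have h := h1.integrable_mul hφ.norm
  refine h.congr (Filter.Eventually.of_forall fun x => ?_)
  simp [mul_assoc]

theorem integrable_gaussian_mul {a : ℝ} (ha : 0 < a) {φ : V → ℂ} (hφ : MemLp φ 2 volume) :
    Integrable (fun x => gaussian V a ha x * φ x) volume :=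
  ((gaussian V a ha).memLp 2 volume).integrable_mul hφ

/-- The character is expanded in its power series and integrated term by term, with the exponential
moments as domination; each term is a vanishing moment. -/
theorem fourier_gaussian_mul_eq_zero {a : ℝ} (ha : 0 < a) {φ : V → ℂ} (hφ : MemLp φ 2 volume)
    (h : ∀ (v : V) (k : ℕ), ∫ x, ((inner ℝ x v : ℝ) : ℂ) ^ k * (gaussian V a ha x * φ x) = 0) :
    𝓕 (fun x => gaussian V a ha x * φ x) = 0 := by
  ext w
  rw [Real.fourier_eq']
  have key := hasSum_integral_of_dominated_convergence (μ := (volume : Measure V))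
    (F := fun (k : ℕ) x => ((k.factorial : ℂ)⁻¹ * (-2 * Real.pi * Complex.I) ^ k) *
      (((inner ℝ x w : ℝ) : ℂ) ^ k * (gaussian V a ha x * φ x)))
    (f := fun x => Complex.exp (↑(-2 * Real.pi * inner ℝ x w) * Complex.I) •
      (gaussian V a ha x * φ x))
    (fun k x => (k.factorial : ℝ)⁻¹ * |inner ℝ x ((2 * Real.pi) • w)| ^ k *
      ‖gaussian V a ha x * φ x‖) ?_ ?_ ?_ ?_ ?_
  · simp only [integral_const_mul, h, mul_zero] at key
    exact key.unique hasSum_zero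
  · intro k
    refine AEStronglyMeasurable.const_mul (AEStronglyMeasurable.mul ?_
      (integrable_gaussian_mul ha hφ).1) _
    exact Continuous.aestronglyMeasurable (by fun_prop)
  · intro k
    refine Filter.Eventually.of_forall fun x => le_of_eq ?_
    simp only [norm_mul, norm_pow, norm_inv, Complex.norm_natCast, Complex.norm_real,
      inner_smul_right, abs_mul, Complex.norm_I, norm_neg, Real.norm_eq_abs,
      Complex.norm_ofNat, Nat.abs_ofNat, mul_pow]
    ring
  · refine Filter.Eventually.of_forall fun x => Summable.mul_right _ ?_
    simpa [div_eq_inv_mul] using Real.summable_pow_div_factorial |inner ℝ x ((2 * Real.pi) • w)|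
  · refine (integrable_exp_inner_mul_gaussian_mul ha hφ ((2 * Real.pi) • w)).congr
      (Filter.Eventually.of_forall fun x => ?_)
    simp only
    rw [tsum_mul_right, Real.exp_eq_exp_ℝ, NormedSpace.exp_eq_tsum_div]
    simp [div_eq_inv_mul]
  · refine Filter.Eventually.of_forall fun x => ?_
    have := (NormedSpace.expSeries_div_hasSum_exp (𝔸 := ℂ)
      (↑(-2 * Real.pi * inner ℝ x w) * Complex.I)).mul_right (gaussian V a ha x * φ x)
    rw [← Complex.exp_eq_exp_ℂ] at this
    refine this.congr_fun fun k => ?_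
    push_cast
    ring

/-- The polynomials times a Gaussian are total in `L²`. -/
theorem eq_zero_of_integral_inner_pow_mul_gaussian {a : ℝ} (ha : 0 < a)
    (φ : Lp ℂ 2 (volume : Measure V))
    (h : ∀ (v : V) (k : ℕ), ∫ x, ((inner ℝ x v : ℝ) : ℂ) ^ k * (gaussian V a ha x * φ x) = 0) :
    φ = 0 := by
  have hint := integrable_gaussian_mul ha (Lp.memLp φ)
  have hF := fourier_gaussian_mul_eq_zero ha (Lp.memLp φ) h
  -- Every test function χ is the Fourier transform of 𝓕⁻ χ, so pairing with χ is pairing 𝓕⁻ χ with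
  -- the vanishing Fourier transform.
  have hzero : Lp.toTemperedDistributionCLM ℂ (volume : Measure V) 1 (hint.toL1 _) = 0 := by
    ext χ
    rw [Lp.toTemperedDistributionCLM_apply, Lp.toTemperedDistribution_apply]
    have e1 : ∫ x, χ x • (hint.toL1 _ : V → ℂ) x = ∫ x, χ x • (gaussian V a ha x * φ x) := by
      refine integral_congr_ae ?_
      filter_upwards [hint.coeFn_toL1] with x hx
      rw [hx]
    have e2 := VectorFourier.integral_fourierIntegral_smul_eq_flip (μ := (volume : Measure V))
      (ν := (volume : Measure V)) (L := innerₗ V) Real.continuous_fourierChar continuous_inner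
      (𝓕⁻ χ).integrable hint
    have e3 : VectorFourier.fourierIntegral Real.fourierChar volume (innerₗ V)
        (𝓕⁻ χ : 𝓢(V, ℂ)) = χ := by
      have : 𝓕 (𝓕⁻ χ) = χ := FourierTransform.fourier_fourierInv_eq χ
      conv_rhs => rw [← this]
      rfl
    have e4 : VectorFourier.fourierIntegral Real.fourierChar volume (innerₗ V).flip
        (fun x => gaussian V a ha x * φ x) = 0 := by
      rw [flip_innerₗ]
      exact hF
    rw [e3, e4] at e2
    rw [e1, e2]
    simp
  have hL1 : hint.toL1 _ = 0 := by
    have hk := Lp.ker_toTemperedDistributionCLM_eq_bot (E := V) (F := ℂ) (μ := volume) (p := 1)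
    exact LinearMap.ker_eq_bot'.mp hk _ hzero
  rw [Lp.eq_zero_iff_ae_eq_zero]
  have h0 : (fun x => gaussian V a ha x * φ x) =ᵐ[volume] 0 :=
    hint.coeFn_toL1.symm.trans ((Lp.eq_zero_iff_ae_eq_zero).mp hL1)
  filter_upwards [h0] with x hx
  simpa using hx

end Completeness

end Gaussian

end Thermal

end

noncomputable section

namespace Thermal

/-! ### Algebra of the canonical commutation relations -/

section CanonicalCommutation

/-- Induction on multi-indices. -/
theorem multiIndex_induction {d : ℕ} {P : (Fin d → ℕ) → Prop} (h0 : P 0)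
    (hs : ∀ n j, P n → P (n + Pi.single j 1)) (n : Fin d → ℕ) : P n := by
  induction hk : ∑ j, n j generalizing n with
  | zero =>
    have : n = 0 := by
      ext j
      exact (Finset.sum_eq_zero_iff.mp hk) j (Finset.mem_univ j)
    exact this ▸ h0
  | succ k ih =>
    obtain ⟨j, -, hj⟩ := Finset.exists_ne_zero_of_sum_ne_zero (hk.trans_ne (Nat.succ_ne_zero k))
    have hle : Pi.single j 1 ≤ n := by
      intro i
      rcases eq_or_ne i j with rfl | h
      · simpa using Nat.one_le_iff_ne_zero.mpr hj
      · simp [h]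
    have hn : n = (n - Pi.single j 1) + Pi.single j 1 := (tsub_add_cancel_of_le hle).symm
    rw [hn]
    refine hs _ j (ih _ ?_)
    have h2 := congrArg (fun m : Fin d → ℕ => ∑ i, m i) hn
    simp only [Pi.add_apply, Finset.sum_add_distrib, Finset.sum_pi_single', hk,
      Finset.mem_univ, if_true] at h2
    lia

variable {d : ℕ} {M : Type*} [AddCommGroup M] [Module ℂ M]

theorem pairwise_commute_powersHom {cr : Fin d → Module.End ℂ M}
    (hcr : ∀ j k, Commute (cr j) (cr k)) :
    Pairwise fun j k => ∀ x y : Multiplicative ℕ,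
      Commute (powersHom (Module.End ℂ M) (cr j) x) (powersHom (Module.End ℂ M) (cr k) y) :=
  fun j k _ x y => by simpa only [powersHom_apply] using (hcr j k).pow_pow _ _

/-- The vector `∏ⱼ (crⱼ) ^ nⱼ g`, for commuting operators `crⱼ`. -/
def excitation (cr : Fin d → Module.End ℂ M) (hcr : ∀ j k, Commute (cr j) (cr k)) (g : M)
    (n : Fin d → ℕ) : M :=
  MonoidHom.noncommPiCoprod (N := fun _ : Fin d => Multiplicative ℕ)
    (fun j => powersHom (Module.End ℂ M) (cr j))
    (pairwise_commute_powersHom hcr) (fun j => Multiplicative.ofAdd (n j)) g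

variable {cr ad : Fin d → Module.End ℂ M} {hcr : ∀ j k, Commute (cr j) (cr k)} {g : M}

theorem excitation_zero : excitation cr hcr g 0 = g := by
  unfold excitation
  have : (fun j : Fin d => Multiplicative.ofAdd ((0 : Fin d → ℕ) j)) = 1 := rfl
  rw [this, map_one, Module.End.one_apply]

theorem excitation_add_single (n : Fin d → ℕ) (j : Fin d) :
    excitation cr hcr g (n + Pi.single j 1) = cr j (excitation cr hcr g n) := by
  unfold excitation
  have : (fun k : Fin d => Multiplicative.ofAdd ((n + Pi.single j 1 : Fin d → ℕ) k)) =
      Pi.mulSingle j (Multiplicative.ofAdd 1) * fun k : Fin d => Multiplicative.ofAdd (n k) := by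
    ext k
    rcases eq_or_ne k j with rfl | h
    · simp [add_comm]
    · simp [h]
  rw [this, map_mul, MonoidHom.noncommPiCoprod_mulSingle, Module.End.mul_apply]
  simp

/-- Moving `ad j` through the product leaves one summand for each factor `cr j`, until `g` is
annihilated. If n j = 0, the truncated subtraction gives back n, which is harmless because the
coefficient is 0. -/
theorem annihilation_excitation
    (hccr : ∀ j k v, ad j (cr k v) = cr k (ad j v) + if j = k then v else 0)
    (hg : ∀ j, ad j g = 0) (j : Fin d) (n : Fin d → ℕ) :
    ad j (excitation cr hcr g n) = (n j : ℂ) • excitation cr hcr g (n - Pi.single j 1) := by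
  induction n using multiIndex_induction with
  | h0 => simp [excitation_zero, hg]
  | hs m k ih =>
    rw [excitation_add_single, hccr, ih, map_smul, ← excitation_add_single]
    rcases eq_or_ne j k with rfl | h
    · rw [add_tsub_cancel_right]
      rcases Nat.eq_zero_or_pos (m j) with h0 | h0
      · simp [h0]
      · rw [tsub_add_cancel_of_le]
        · simp [add_smul]
        · intro i
          rcases eq_or_ne i j with rfl | h
          · simpa using Nat.one_le_iff_ne_zero.mpr h0.ne'
          · simp [h]
    · have : m - Pi.single j 1 + Pi.single k 1 = m + Pi.single k 1 - Pi.single j 1 := by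
        ext i
        rcases eq_or_ne i j with rfl | h'
        · simp [h]
        · simp [h']
      rw [this]
      simp [h]

theorem annihilation_excitation_add_single
    (hccr : ∀ j k v, ad j (cr k v) = cr k (ad j v) + if j = k then v else 0)
    (hg : ∀ j, ad j g = 0) (j : Fin d) (n : Fin d → ℕ) :
    ad j (excitation cr hcr g (n + Pi.single j 1)) = ((n j : ℂ) + 1) • excitation cr hcr g n := by
  rw [annihilation_excitation hccr hg, add_tsub_cancel_right]
  simp

theorem creation_annihilation_excitation
    (hccr : ∀ j k v, ad j (cr k v) = cr k (ad j v) + if j = k then v else 0)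
    (hg : ∀ j, ad j g = 0) (j : Fin d) (n : Fin d → ℕ) :
    cr j (ad j (excitation cr hcr g n)) = (n j : ℂ) • excitation cr hcr g n := by
  rw [annihilation_excitation hccr hg, map_smul, ← excitation_add_single]
  rcases Nat.eq_zero_or_pos (n j) with h0 | h0
  · simp [h0]
  · rw [tsub_add_cancel_of_le]
    intro i
    rcases eq_or_ne i j with rfl | h
    · simpa using Nat.one_le_iff_ne_zero.mpr h0.ne'
    · simp [h]

variable {B : M →ₗ[ℂ] M →ₗ[ℂ] ℂ}

/-- The number operator `cr j ∘ ad j` is symmetric for B, and the two vectors are eigenvectors of it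
with distinct eigenvalues for some j. -/
theorem bilin_excitation_of_ne
    (hccr : ∀ j k v, ad j (cr k v) = cr k (ad j v) + if j = k then v else 0)
    (hg : ∀ j, ad j g = 0) (hB : ∀ j v w, B (cr j v) w = B v (ad j w))
    (hB' : ∀ j v w, B v (cr j w) = B (ad j v) w) {m n : Fin d → ℕ} (hmn : m ≠ n) :
    B (excitation cr hcr g m) (excitation cr hcr g n) = 0 := by
  obtain ⟨j, hj⟩ := Function.ne_iff.mp hmn
  have h1 := congrArg (B (excitation cr hcr g m))
    (creation_annihilation_excitation (hcr := hcr) hccr hg j n)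
  have h2 := congrArg (fun v => B v (excitation cr hcr g n))
    (creation_annihilation_excitation (hcr := hcr) hccr hg j m)
  simp only [hB, hB', map_smul, LinearMap.smul_apply, smul_eq_mul] at h1 h2
  have h3 : ((m j : ℂ) - n j) * B (excitation cr hcr g m) (excitation cr hcr g n) = 0 := by
    rw [sub_mul, ← h1, ← h2, sub_self]
  rcases mul_eq_zero.mp h3 with h | h
  · exact absurd (by exact_mod_cast sub_eq_zero.mp h) hj
  · exact h

theorem bilin_excitation_add_single
    (hccr : ∀ j k v, ad j (cr k v) = cr k (ad j v) + if j = k then v else 0)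
    (hg : ∀ j, ad j g = 0) (hB : ∀ j v w, B (cr j v) w = B v (ad j w))
    (n : Fin d → ℕ) (j : Fin d) :
    B (excitation cr hcr g (n + Pi.single j 1)) (excitation cr hcr g (n + Pi.single j 1)) =
      ((n j : ℂ) + 1) * B (excitation cr hcr g n) (excitation cr hcr g n) := by
  conv_lhs => rw [excitation_add_single n j, hB, ← excitation_add_single,
    annihilation_excitation_add_single hccr hg]
  simp

end CanonicalCommutation

/-! ### Position, derivative and ladder operators on the Schwartz space -/

section Schwartz

variable {d : ℕ}

/-- Multiplication by the coordinate `xⱼ` on the Schwartz space. -/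
def positionEnd (j : Fin d) : Module.End ℂ 𝓢(Space d, ℂ) :=
  (SchwartzMap.smulLeftCLM ℂ (fun x : Space d => (x j : ℂ))).toLinearMap

/-- The partial derivative `∂ⱼ` on the Schwartz space. -/
def derivEnd (j : Fin d) : Module.End ℂ 𝓢(Space d, ℂ) :=
  (LineDeriv.lineDerivOpCLM ℂ 𝓢(Space d, ℂ) (EuclideanSpace.single j (1 : ℝ))).toLinearMap

@[fun_prop]
theorem hasTemperateGrowth_coord (j : Fin d) :
    Function.HasTemperateGrowth (fun x : Space d => (x j : ℂ)) :=
  (Complex.ofRealCLM ∘L EuclideanSpace.proj (𝕜 := ℝ) j).hasTemperateGrowth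

theorem positionEnd_apply (j : Fin d) (f : 𝓢(Space d, ℂ)) (x : Space d) :
    positionEnd j f x = (x j : ℂ) * f x :=
  SchwartzMap.smulLeftCLM_apply_apply (hasTemperateGrowth_coord j) f x

theorem derivEnd_apply (j : Fin d) (f : 𝓢(Space d, ℂ)) (x : Space d) :
    derivEnd j f x = fderiv ℝ f x (EuclideanSpace.single j 1) :=
  SchwartzMap.lineDerivOp_apply_eq_fderiv _ f x

theorem positionEnd_commute (j k : Fin d) :
    Commute (positionEnd j) (positionEnd k) := by
  refine LinearMap.ext fun f => SchwartzMap.ext fun x => ?_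
  simp only [Module.End.mul_apply, positionEnd_apply]
  ring

theorem derivEnd_commute (j k : Fin d) : Commute (derivEnd j) (derivEnd k) := by
  refine LinearMap.ext fun f => SchwartzMap.ext fun x => ?_
  have key : ∀ j k : Fin d, derivEnd j (derivEnd k f) x =
      fderiv ℝ (fderiv ℝ f) x (EuclideanSpace.single j 1) (EuclideanSpace.single k 1) := by
    intro j k
    have h1 : (derivEnd k f : Space d → ℂ) =
        fun y => fderiv ℝ f y (EuclideanSpace.single k 1) := funext (derivEnd_apply k f)
    have h2 : DifferentiableAt ℝ (fderiv ℝ f) x :=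
      ((f.smooth 2).fderiv_right (m := 1) (by norm_num)).differentiable (by norm_num) x
    rw [derivEnd_apply, h1, fderiv_clm_apply h2 (differentiableAt_const _)]
    simp
  simp only [Module.End.mul_apply, key]
  exact ((f.smooth 2).contDiffAt.isSymmSndFDerivAt (by simp)) _ _

theorem derivEnd_positionEnd (j k : Fin d) (f : 𝓢(Space d, ℂ)) :
    derivEnd j (positionEnd k f) = positionEnd k (derivEnd j f) + if j = k then f else 0 := by
  ext x
  have h1 : (positionEnd k f : Space d → ℂ) = fun y => (y k : ℂ) * f y :=
    funext (positionEnd_apply k f)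
  have h2 : HasFDerivAt (fun y : Space d => (y k : ℂ))
      (Complex.ofRealCLM ∘L EuclideanSpace.proj (𝕜 := ℝ) k) x :=
    (Complex.ofRealCLM ∘L EuclideanSpace.proj (𝕜 := ℝ) k).hasFDerivAt
  rw [derivEnd_apply, h1, (h2.fun_mul (f.hasFDerivAt x)).fderiv]
  simp only [add_apply, smul_apply, positionEnd_apply, derivEnd_apply]
  rcases eq_or_ne j k with rfl | h
  · simp
  · simp [h, Ne.symm h]

theorem integrable_mul (f g : 𝓢(Space d, ℂ)) : Integrable (fun x => f x * g x) :=
  (f.memLp 2 volume).integrable_mul (g.memLp 2 volume)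

/-- The bilinear pairing `∫ f g` on the Schwartz space. -/
def pairing (d : ℕ) : 𝓢(Space d, ℂ) →ₗ[ℂ] 𝓢(Space d, ℂ) →ₗ[ℂ] ℂ :=
  LinearMap.mk₂ ℂ (fun f g => ∫ x, f x * g x)
    (fun f f' g => by
      simp only [add_apply, add_mul]
      exact integral_add (integrable_mul f g) (integrable_mul f' g))
    (fun c f g => by
      simp only [smul_apply, smul_eq_mul, mul_assoc, integral_const_mul])
    (fun f g g' => by
      simp only [add_apply, mul_add]
      exact integral_add (integrable_mul f g) (integrable_mul f g'))
    (fun c f g => by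
      simp only [smul_apply, smul_eq_mul, mul_left_comm _ c, integral_const_mul])

theorem pairing_apply (f g : 𝓢(Space d, ℂ)) : pairing d f g = ∫ x, f x * g x := rfl

theorem toDist_toLp (f : 𝓢(Space d, ℂ)) :
    toDist d (f.toLp 2) = SchwartzMap.toTemperedDistributionCLM (Space d) ℂ volume f :=
  Lp.toTemperedDistribution_toLp_eq f

theorem toDist_apply (φ : L2 d) (f : 𝓢(Space d, ℂ)) : toDist d φ f = ∫ x, f x * φ x :=
  Lp.toTemperedDistribution_apply φ f

theorem pairing_positionEnd (j : Fin d) (f g : 𝓢(Space d, ℂ)) :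
    pairing d (positionEnd j f) g = pairing d f (positionEnd j g) := by
  simp only [pairing_apply, positionEnd_apply]
  refine integral_congr_ae (Filter.Eventually.of_forall fun x => ?_)
  ring

theorem pairing_derivEnd (j : Fin d) (f g : 𝓢(Space d, ℂ)) :
    pairing d (derivEnd j f) g = -pairing d f (derivEnd j g) := by
  simp only [pairing_apply]
  rw [← neg_eq_iff_eq_neg]
  exact (SchwartzMap.integral_mul_lineDerivOp_right_eq_neg_left f g _).symm

/-- The normalization `(2ħ)^{-1/2}` of the ladder operators. -/
def ladderScale (ħ : ℝ) : ℝ := (Real.sqrt (2 * ħ))⁻¹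

theorem ladderScale_pos {ħ : ℝ} (hħ : 0 < ħ) : 0 < ladderScale ħ := by
  unfold ladderScale; positivity

theorem ladderScale_sq {ħ : ℝ} (hħ : 0 < ħ) : ladderScale ħ ^ 2 = (2 * ħ)⁻¹ := by
  rw [ladderScale, inv_pow, Real.sq_sqrt (by positivity)]

theorem ladderScale_mul_self {ħ : ℝ} (hħ : 0 < ħ) :
    (ladderScale ħ : ℂ) * ladderScale ħ * (2 * ħ) = 1 := by
  have := ladderScale_sq hħ
  have h : ladderScale ħ * ladderScale ħ * (2 * ħ) = 1 := by
    rw [← sq, this]; field_simp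
  exact_mod_cast h

/-- The annihilation operator `aⱼ = (xⱼ + ħ ∂ⱼ) / √(2ħ)` on the Schwartz space. -/
def annihilation (ħ : ℝ) (j : Fin d) : Module.End ℂ 𝓢(Space d, ℂ) :=
  (ladderScale ħ : ℂ) • (positionEnd j + (ħ : ℂ) • derivEnd j)

/-- The creation operator `aⱼ* = (xⱼ - ħ ∂ⱼ) / √(2ħ)` on the Schwartz space. -/
def creation (ħ : ℝ) (j : Fin d) : Module.End ℂ 𝓢(Space d, ℂ) :=
  (ladderScale ħ : ℂ) • (positionEnd j - (ħ : ℂ) • derivEnd j)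

theorem annihilation_apply (ħ : ℝ) (j : Fin d) (f : 𝓢(Space d, ℂ)) :
    annihilation ħ j f = (ladderScale ħ : ℂ) • (positionEnd j f + (ħ : ℂ) • derivEnd j f) := rfl

theorem creation_apply (ħ : ℝ) (j : Fin d) (f : 𝓢(Space d, ℂ)) :
    creation ħ j f = (ladderScale ħ : ℂ) • (positionEnd j f - (ħ : ℂ) • derivEnd j f) := rfl

theorem derivEnd_eq_ladder {ħ : ℝ} (hħ : 0 < ħ) (j : Fin d) (f : 𝓢(Space d, ℂ)) :
    derivEnd j f = (ladderScale ħ : ℂ) • (annihilation ħ j f - creation ħ j f) := by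
  rw [annihilation_apply, creation_apply]
  linear_combination (norm := module) (-(ladderScale_mul_self hħ)) • derivEnd j f

theorem positionEnd_eq_ladder {ħ : ℝ} (hħ : 0 < ħ) (j : Fin d) (f : 𝓢(Space d, ℂ)) :
    positionEnd j f = ((ħ : ℂ) * ladderScale ħ) • (annihilation ħ j f + creation ħ j f) := by
  rw [annihilation_apply, creation_apply]
  linear_combination (norm := module) (-(ladderScale_mul_self hħ)) • positionEnd j f

theorem creation_commute (ħ : ℝ) (j k : Fin d) :
    Commute (creation (d := d) ħ j) (creation ħ k) := by
  have hX := fun f => LinearMap.congr_fun (positionEnd_commute j k) f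
  have hD := fun f => LinearMap.congr_fun (derivEnd_commute j k) f
  refine LinearMap.ext fun f => ?_
  simp only [Module.End.mul_apply] at hX hD
  simp only [Module.End.mul_apply, creation_apply, map_smul, map_sub, derivEnd_positionEnd, hX, hD]
  rcases eq_or_ne j k with rfl | h
  · module
  · simp only [h, Ne.symm h, if_false]
    module

/-- Only [ħ∂ⱼ, xₖ] and -[xⱼ, ħ∂ₖ] survive, each equal to ħδⱼₖ, and the squared scale is 1/(2ħ). -/
theorem annihilation_creation {ħ : ℝ} (hħ : 0 < ħ) (j k : Fin d) (f : 𝓢(Space d, ℂ)) :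
    annihilation ħ j (creation ħ k f) =
      creation ħ k (annihilation ħ j f) + if j = k then f else 0 := by
  have hX := fun f => LinearMap.congr_fun (positionEnd_commute j k) f
  have hD := fun f => LinearMap.congr_fun (derivEnd_commute j k) f
  simp only [Module.End.mul_apply] at hX hD
  simp only [annihilation_apply, creation_apply, map_smul, map_sub, map_add,
    derivEnd_positionEnd, hX, hD]
  rcases eq_or_ne j k with rfl | h
  · simp only [if_true]
    linear_combination (norm := module) (ladderScale_mul_self hħ) • f
  · simp only [h, Ne.symm h, if_false]
    module

theorem pairing_creation (ħ : ℝ) (j : Fin d) (f g : 𝓢(Space d, ℂ)) :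
    pairing d (creation ħ j f) g = pairing d f (annihilation ħ j g) := by
  simp [creation_apply, annihilation_apply, pairing_positionEnd, pairing_derivEnd]

theorem pairing_creation_right (ħ : ℝ) (j : Fin d) (f g : 𝓢(Space d, ℂ)) :
    pairing d f (creation ħ j g) = pairing d (annihilation ħ j f) g := by
  simp [creation_apply, annihilation_apply, pairing_positionEnd, pairing_derivEnd, sub_eq_add_neg]

/-- The ground state `exp (-|x|² / (2ħ))`, not normalized. -/
def groundState (d : ℕ) {ħ : ℝ} (hħ : 0 < ħ) : 𝓢(Space d, ℂ) :=
  gaussian (Space d) (2 * ħ)⁻¹ (by positivity)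

theorem annihilation_groundState {ħ : ℝ} (hħ : 0 < ħ) (j : Fin d) :
    annihilation ħ j (groundState d hħ) = 0 := by
  ext x
  have h1 : HasFDerivAt (fun y : Space d => Real.exp (-(2 * ħ)⁻¹ * ‖y‖ ^ 2))
      (Real.exp (-(2 * ħ)⁻¹ * ‖x‖ ^ 2) • (-(2 * ħ)⁻¹) • (2 • innerSL ℝ x)) x :=
    ((hasStrictFDerivAt_norm_sq x).hasFDerivAt.const_mul _).exp
  have h2 := (Complex.ofRealCLM.hasFDerivAt.comp x h1).fderiv
  have h3 : (groundState d hħ : Space d → ℂ) =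
    Complex.ofRealCLM ∘ fun y : Space d => Real.exp (-(2 * ħ)⁻¹ * ‖y‖ ^ 2) := rfl
  rw [annihilation_apply]
  simp only [smul_apply, add_apply, positionEnd_apply, derivEnd_apply]
  rw [h3, h2]
  have hħ' : (ħ : ℂ) ≠ 0 := by exact_mod_cast hħ.ne'
  simp [EuclideanSpace.inner_single_right]
  field_simp
  simp

/-- A complex-valued Schwartz function with real values. -/
def IsRealValued (f : 𝓢(Space d, ℂ)) : Prop := ∀ x, (starRingEnd ℂ) (f x) = f x

theorem IsRealValued.smul {f : 𝓢(Space d, ℂ)} (hf : IsRealValued f) (c : ℝ) :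
    IsRealValued ((c : ℂ) • f) := fun x => by simp [hf x]

theorem IsRealValued.sub {f g : 𝓢(Space d, ℂ)} (hf : IsRealValued f) (hg : IsRealValued g) :
    IsRealValued (f - g) := fun x => by simp [hf x, hg x]

theorem IsRealValued.positionEnd {f : 𝓢(Space d, ℂ)} (hf : IsRealValued f) (j : Fin d) :
    IsRealValued (positionEnd j f) := fun x => by simp [positionEnd_apply, hf x]

theorem IsRealValued.derivEnd {f : 𝓢(Space d, ℂ)} (hf : IsRealValued f) (j : Fin d) :
    IsRealValued (derivEnd j f) := fun x => by
  have h := (Complex.conjCLE.toContinuousLinearMap.hasFDerivAt.comp x (f.hasFDerivAt x)).fderiv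
  have h' : ((Complex.conjCLE.toContinuousLinearMap : ℂ → ℂ) ∘ f) = f := funext hf
  rw [h'] at h
  rw [derivEnd_apply]
  conv_rhs => rw [h]
  rfl

theorem IsRealValued.creation {f : 𝓢(Space d, ℂ)} (hf : IsRealValued f) (ħ : ℝ) (j : Fin d) :
    IsRealValued (creation ħ j f) :=
  ((hf.positionEnd j).sub ((hf.derivEnd j).smul ħ)).smul _

theorem isRealValued_groundState {ħ : ℝ} (hħ : 0 < ħ) : IsRealValued (groundState d hħ) :=
  fun _ => Complex.conj_ofReal _

/-- Real values remove the conjugation from the inner product. Identities between distributions,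
tested on Hermite functions, thus become identities between Hermite coefficients. -/
theorem inner_toLp_eq_toDist {f : 𝓢(Space d, ℂ)} (hf : IsRealValued f) (φ : L2 d) :
    inner ℂ (f.toLp 2 : L2 d) φ = toDist d φ f := by
  rw [toDist_apply, MeasureTheory.L2.inner_def]
  refine integral_congr_ae ?_
  filter_upwards [f.coeFn_toLp 2 volume] with x hx
  rw [hx, RCLike.inner_apply, hf x, mul_comm]

theorem inner_toLp_toLp {f : 𝓢(Space d, ℂ)} (hf : IsRealValued f) (g : 𝓢(Space d, ℂ)) :
    inner ℂ (f.toLp 2 : L2 d) (g.toLp 2) = pairing d f g := by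
  rw [inner_toLp_eq_toDist hf, toDist_toLp]
  exact SchwartzMap.toTemperedDistributionCLM_apply_apply volume g f

end Schwartz

end Thermal

end

noncomputable section

namespace Thermal

/-! ### The Hermite basis -/

section Hermite

variable {d : ℕ} {ħ : ℝ}

/-- The embedding of the Schwartz space into `L²(ℝᵈ)`. -/
def toL2 (d : ℕ) : 𝓢(Space d, ℂ) →ₗ[ℂ] L2 d := (SchwartzMap.toLpCLM ℂ ℂ 2 volume).toLinearMap

theorem toL2_apply (f : 𝓢(Space d, ℂ)) : toL2 d f = f.toLp 2 := rfl

theorem inner_toL2 {f : 𝓢(Space d, ℂ)} (hf : IsRealValued f) (φ : L2 d) :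
    inner ℂ (toL2 d f) φ = toDist d φ f := inner_toLp_eq_toDist hf φ

/-- The unnormalized Hermite function `∏ⱼ (aⱼ*) ^ nⱼ exp (-|x|² / (2ħ))`. -/
def hermiteRaw (hħ : 0 < ħ) (n : Fin d → ℕ) : 𝓢(Space d, ℂ) :=
  excitation (creation ħ) (creation_commute ħ) (groundState d hħ) n

theorem isRealValued_hermiteRaw (hħ : 0 < ħ) (n : Fin d → ℕ) : IsRealValued (hermiteRaw hħ n) := by
  induction n using multiIndex_induction with
  | h0 =>
    rw [hermiteRaw, excitation_zero]
    exact isRealValued_groundState hħ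
  | hs n j ih =>
    rw [hermiteRaw, excitation_add_single]
    exact ih.creation ħ j

theorem pairing_hermiteRaw_self (hħ : 0 < ħ) (n : Fin d → ℕ) :
    pairing d (hermiteRaw hħ n) (hermiteRaw hħ n) = ((‖toL2 d (hermiteRaw hħ n)‖ ^ 2 : ℝ) : ℂ) := by
  rw [← inner_toLp_toLp (isRealValued_hermiteRaw hħ n), ← toL2_apply, inner_self_eq_norm_sq_to_K]
  norm_cast

theorem norm_hermiteRaw_add_single (hħ : 0 < ħ) (n : Fin d → ℕ) (j : Fin d) :
    ‖toL2 d (hermiteRaw hħ (n + Pi.single j 1))‖ =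
      Real.sqrt (n j + 1) * ‖toL2 d (hermiteRaw hħ n)‖ := by
  have h := bilin_excitation_add_single (hcr := creation_commute ħ) (B := pairing d)
    (annihilation_creation hħ) (annihilation_groundState hħ) (pairing_creation ħ) n j
  change pairing d (hermiteRaw hħ _) (hermiteRaw hħ _) =
    _ * pairing d (hermiteRaw hħ _) (hermiteRaw hħ _) at h
  rw [pairing_hermiteRaw_self, pairing_hermiteRaw_self] at h
  have h' : ‖toL2 d (hermiteRaw hħ (n + Pi.single j 1))‖ ^ 2 =
      (n j + 1) * ‖toL2 d (hermiteRaw hħ n)‖ ^ 2 := by exact_mod_cast h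
  rw [← Real.sqrt_sq (norm_nonneg (toL2 d (hermiteRaw hħ (n + Pi.single j 1)))), h',
    Real.sqrt_mul (by positivity), Real.sqrt_sq (norm_nonneg _)]

theorem norm_hermiteRaw_pos (hħ : 0 < ħ) (n : Fin d → ℕ) : 0 < ‖toL2 d (hermiteRaw hħ n)‖ := by
  induction n using multiIndex_induction with
  | h0 =>
    rw [norm_pos_iff, hermiteRaw, excitation_zero]
    intro h
    have h0 : groundState d hħ = 0 := by
      refine SchwartzMap.injective_toLp 2 volume ?_
      have := (toL2 d).map_zero
      exact h.trans this.symm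
    have := congrArg (fun f : 𝓢(Space d, ℂ) => f 0) h0
    simp [groundState] at this
  | hs n j ih =>
    rw [norm_hermiteRaw_add_single]
    exact mul_pos (Real.sqrt_pos.mpr (by positivity)) ih

/-- The normalized Hermite function with multi-index `n`, as a Schwartz function. -/
def hermite (hħ : 0 < ħ) (n : Fin d → ℕ) : 𝓢(Space d, ℂ) :=
  ((‖toL2 d (hermiteRaw hħ n)‖⁻¹ : ℝ) : ℂ) • hermiteRaw hħ n

theorem isRealValued_hermite (hħ : 0 < ħ) (n : Fin d → ℕ) : IsRealValued (hermite hħ n) :=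
  (isRealValued_hermiteRaw hħ n).smul _

theorem creation_hermite (hħ : 0 < ħ) (n : Fin d → ℕ) (j : Fin d) :
    creation ħ j (hermite hħ n) = (Real.sqrt (n j + 1) : ℂ) • hermite hħ (n + Pi.single j 1) := by
  have h : hermiteRaw hħ (n + Pi.single j 1) = creation ħ j (hermiteRaw hħ n) :=
    excitation_add_single n j
  rw [hermite, hermite, map_smul, ← h, smul_smul, norm_hermiteRaw_add_single]
  congr 1
  have h1 := (norm_hermiteRaw_pos hħ n).ne'
  have h2 : Real.sqrt (n j + 1) ≠ 0 := (Real.sqrt_pos.mpr (by positivity)).ne'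
  rw [← Complex.ofReal_mul]
  congr 1
  field_simp

theorem annihilation_hermite_add_single (hħ : 0 < ħ) (n : Fin d → ℕ) (j : Fin d) :
    annihilation ħ j (hermite hħ (n + Pi.single j 1)) =
      (Real.sqrt (n j + 1) : ℂ) • hermite hħ n := by
  have h : annihilation ħ j (hermiteRaw hħ (n + Pi.single j 1)) = ((n j : ℂ) + 1) • hermiteRaw hħ n :=
    annihilation_excitation_add_single (annihilation_creation hħ) (annihilation_groundState hħ) j n
  rw [hermite, hermite, map_smul, h, smul_smul, smul_smul, norm_hermiteRaw_add_single]
  congr 1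
  have h1 := (norm_hermiteRaw_pos hħ n).ne'
  have h2 : Real.sqrt (n j + 1) ≠ 0 := (Real.sqrt_pos.mpr (by positivity)).ne'
  have h3 : Real.sqrt (n j + 1) * Real.sqrt (n j + 1) = n j + 1 :=
    Real.mul_self_sqrt (by positivity)
  have h4 : ((n j : ℂ) + 1) = ((n j + 1 : ℝ) : ℂ) := by push_cast; rfl
  rw [h4, ← Complex.ofReal_mul, ← Complex.ofReal_mul]
  congr 1
  generalize Real.sqrt (n j + 1) = r at h2 h3 ⊢
  rw [← h3]
  field_simp

theorem annihilation_hermite (hħ : 0 < ħ) (n : Fin d → ℕ) (j : Fin d) :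
    annihilation ħ j (hermite hħ n) =
      (Real.sqrt (n j) : ℂ) • hermite hħ (n - Pi.single j 1) := by
  rcases Nat.eq_zero_or_pos (n j) with h0 | h0
  · have h : annihilation ħ j (hermiteRaw hħ n) =
        (n j : ℂ) • hermiteRaw hħ (n - Pi.single j 1) :=
      annihilation_excitation (annihilation_creation hħ) (annihilation_groundState hħ) j n
    rw [hermite, map_smul, h, h0]
    simp
  · have hle : Pi.single j 1 ≤ n := by
      intro i
      rcases eq_or_ne i j with rfl | h
      · simpa using Nat.one_le_iff_ne_zero.mpr h0.ne'
      · simp [h]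
    have h := annihilation_hermite_add_single hħ (n - Pi.single j 1) j
    rw [tsub_add_cancel_of_le hle] at h
    rw [h]
    have : (((n - Pi.single j 1 : Fin d → ℕ) j : ℕ) : ℝ) + 1 = n j := by
      simp only [Pi.sub_apply, Pi.single_eq_same]
      rw [Nat.cast_sub h0]
      simp
    rw [this]

theorem orthonormal_hermite (hħ : 0 < ħ) :
    Orthonormal ℂ (fun n : Fin d → ℕ => toL2 d (hermite hħ n)) := by
  refine ⟨fun n => ?_, fun m n hmn => ?_⟩
  · have h1 := (norm_hermiteRaw_pos hħ n).ne'
    change ‖toL2 d (hermite hħ n)‖ = 1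
    rw [hermite, map_smul, norm_smul]
    simp [h1]
  · change inner ℂ (toL2 d (hermite hħ m)) (toL2 d (hermite hħ n)) = 0
    rw [toL2_apply, toL2_apply, inner_toLp_toLp (isRealValued_hermite hħ m), hermite, hermite,
      map_smul, map_smul, LinearMap.smul_apply]
    have : pairing d (hermiteRaw hħ m) (hermiteRaw hħ n) = 0 :=
      bilin_excitation_of_ne (annihilation_creation hħ) (annihilation_groundState hħ)
        (pairing_creation ħ) (pairing_creation_right ħ) hmn
    simp [this]

/-- Stability under xⱼ puts every polynomial multiple of the ground state in the span, as needed for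
completeness. -/
theorem positionEnd_mem_span_hermite (hħ : 0 < ħ) (j : Fin d) {f : 𝓢(Space d, ℂ)}
    (hf : f ∈ Submodule.span ℂ (Set.range (hermite (d := d) hħ))) :
    positionEnd j f ∈ Submodule.span ℂ (Set.range (hermite (d := d) hħ)) := by
  induction hf using Submodule.span_induction with
  | mem f hf =>
    obtain ⟨n, rfl⟩ := hf
    rw [positionEnd_eq_ladder hħ, annihilation_hermite, creation_hermite]
    refine Submodule.smul_mem _ _ (add_mem (Submodule.smul_mem _ _ ?_) (Submodule.smul_mem _ _ ?_))
    · exact Submodule.subset_span ⟨_, rfl⟩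
    · exact Submodule.subset_span ⟨_, rfl⟩
  | zero => rw [map_zero]; exact zero_mem _
  | add f g _ _ hf hg => rw [map_add]; exact add_mem hf hg
  | smul c f _ hf => rw [map_smul]; exact Submodule.smul_mem _ _ hf

theorem groundState_mem_span_hermite (hħ : 0 < ħ) :
    groundState d hħ ∈ Submodule.span ℂ (Set.range (hermite (d := d) hħ)) := by
  have h : groundState d hħ =
      ((‖toL2 d (hermiteRaw hħ (0 : Fin d → ℕ))‖ : ℝ) : ℂ) • hermite hħ (0 : Fin d → ℕ) := by
    have h1 := (norm_hermiteRaw_pos hħ (0 : Fin d → ℕ)).ne'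
    rw [hermite, smul_smul, ← Complex.ofReal_mul, mul_inv_cancel₀ h1, Complex.ofReal_one, one_smul,
      hermiteRaw, excitation_zero]
  rw [h]
  exact Submodule.smul_mem _ _ (Submodule.subset_span ⟨_, rfl⟩)

theorem span_hermite_orthogonal (hħ : 0 < ħ) :
    (Submodule.span ℂ (Set.range fun n : Fin d → ℕ => toL2 d (hermite hħ n)))ᗮ = ⊥ := by
  rw [eq_bot_iff]
  intro φ hφ
  rw [Submodule.mem_orthogonal] at hφ
  have h1 : ∀ f ∈ Submodule.span ℂ (Set.range (hermite (d := d) hħ)), toDist d φ f = 0 := by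
    intro f hf
    induction hf using Submodule.span_induction with
    | mem f hf =>
      obtain ⟨n, rfl⟩ := hf
      rw [← inner_toL2 (isRealValued_hermite hħ n)]
      exact hφ _ (Submodule.subset_span ⟨n, rfl⟩)
    | zero => exact map_zero _
    | add f g _ _ hf hg => rw [map_add, hf, hg, add_zero]
    | smul c f _ hf => rw [map_smul, hf, smul_zero]
  rw [Submodule.mem_bot]
  refine eq_zero_of_integral_inner_pow_mul_gaussian (a := (2 * ħ)⁻¹) (by positivity) φ
    fun v k => ?_
  -- L is multiplication by ⟨x, v⟩; its powers applied to the ground state yield the moments that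
  -- have to vanish.
  set L : Module.End ℂ 𝓢(Space d, ℂ) := ∑ j, (v j : ℂ) • positionEnd j with hL
  have hLapp : ∀ (f : 𝓢(Space d, ℂ)) (x : Space d), L f x = ((inner ℝ x v : ℝ) : ℂ) * f x := by
    intro f x
    rw [hL, LinearMap.sum_apply, sum_apply, PiLp.inner_apply, Complex.ofReal_sum, Finset.sum_mul]
    refine Finset.sum_congr rfl fun j _ => ?_
    rw [LinearMap.smul_apply, smul_apply, positionEnd_apply]
    simp [mul_assoc]
  have hmem : ∀ k : ℕ, (L ^ k) (groundState d hħ) ∈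
      Submodule.span ℂ (Set.range (hermite (d := d) hħ)) := by
    intro k
    induction k with
    | zero => exact groundState_mem_span_hermite hħ
    | succ k ih =>
      rw [pow_succ', Module.End.mul_apply, hL, LinearMap.sum_apply]
      exact sum_mem fun j _ => Submodule.smul_mem _ _ (positionEnd_mem_span_hermite hħ j ih)
  have hval : ∀ (k : ℕ) (x : Space d), (L ^ k) (groundState d hħ) x =
      ((inner ℝ x v : ℝ) : ℂ) ^ k * groundState d hħ x := by
    intro k x
    induction k with
    | zero => simp
    | succ k ih => rw [pow_succ', Module.End.mul_apply, hLapp, ih, pow_succ', mul_assoc]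
  have h2 := h1 _ (hmem k)
  rw [toDist_apply] at h2
  simp only [hval, mul_assoc] at h2
  exact h2

/-- The Hilbert basis of `L²(ℝᵈ)` consisting of Hermite functions. -/
def hermiteBasis (d : ℕ) (hħ : 0 < ħ) : HilbertBasis (Fin d → ℕ) ℂ (L2 d) :=
  HilbertBasis.mkOfOrthogonalEqBot (orthonormal_hermite hħ) (span_hermite_orthogonal hħ)

theorem hermiteBasis_apply (hħ : 0 < ħ) (n : Fin d → ℕ) :
    hermiteBasis d hħ n = toL2 d (hermite hħ n) := by
  rw [hermiteBasis, HilbertBasis.coe_mkOfOrthogonalEqBot]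

end Hermite

/-! ### Graphs of the unbounded operators, tested on Hermite functions -/

section Graphs

variable {d : ℕ} {ħ : ℝ}

theorem isClosed_graph_maximalOperator (D : 𝓢'(Space d, ℂ) →L[ℂ] 𝓢'(Space d, ℂ)) :
    IsClosed ((maximalOperator D).graph : Set (L2 d × L2 d)) := by
  have : ((maximalOperator D).graph : Set (L2 d × L2 d)) =
      {p | D (toDist d p.1) = toDist d p.2} := by
    ext p
    exact mem_graph_maximalOperator D p.1 p.2
  rw [this]
  have hc : Continuous (toDist d) :=
    (Lp.toTemperedDistributionCLM ℂ (volume : Measure (Space d)) 2).continuous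
  exact isClosed_eq (D.continuous.comp (hc.comp continuous_fst)) (hc.comp continuous_snd)

theorem toDist_toL2 (f χ : 𝓢(Space d, ℂ)) : toDist d (toL2 d f) χ = pairing d χ f := by
  rw [toDist_apply, pairing_apply]
  refine integral_congr_ae ?_
  filter_upwards [f.coeFn_toLp 2 volume] with x hx
  rw [toL2_apply, hx]

theorem partialDeriv_graph (j : Fin d) (f : 𝓢(Space d, ℂ)) :
    (toL2 d f, toL2 d (derivEnd j f)) ∈ (partialDeriv d j).graph := by
  rw [partialDeriv, mem_graph_maximalOperator]
  ext χ
  rw [toDist_toL2]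
  change toDist d (toL2 d f) (-derivEnd j χ) = _
  rw [toDist_toL2, map_neg, LinearMap.neg_apply, pairing_derivEnd, neg_neg]

/-- A real Schwartz function is itself a test function, so the distributional definition of the
graph is already the integration by parts against every φ in the domain. -/
theorem inner_of_mem_partialDeriv_graph (j : Fin d) {f : 𝓢(Space d, ℂ)} (hf : IsRealValued f)
    {φ ψ : L2 d} (h : (φ, ψ) ∈ (partialDeriv d j).graph) :
    inner ℂ (toL2 d f) ψ = -inner ℂ (toL2 d (derivEnd j f)) φ := by
  rw [partialDeriv, mem_graph_maximalOperator] at h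
  rw [inner_toL2 hf, inner_toL2 (hf.derivEnd j), ← h]
  change toDist d φ (-derivEnd j f) = _
  rw [map_neg]

theorem smulLeftCLM_coord_div (ħ : ℝ) (j : Fin d) (f : 𝓢(Space d, ℂ)) :
    SchwartzMap.smulLeftCLM ℂ (fun x : Space d => (x j : ℂ) / (Complex.I * (ħ : ℂ))) f =
      (Complex.I * ħ)⁻¹ • positionEnd j f := by
  ext x
  have : Function.HasTemperateGrowth (fun x : Space d => (x j : ℂ) / (Complex.I * (ħ : ℂ))) := by
    simp only [div_eq_mul_inv]
    exact (hasTemperateGrowth_coord j).mul (Function.HasTemperateGrowth.const _)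
  rw [SchwartzMap.smulLeftCLM_apply_apply this, smul_apply, positionEnd_apply, smul_eq_mul,
    smul_eq_mul]
  ring

theorem positionOver_graph (j : Fin d) (f : 𝓢(Space d, ℂ)) :
    (toL2 d f, toL2 d ((Complex.I * ħ)⁻¹ • positionEnd j f)) ∈ (positionOver d ħ j).graph := by
  rw [positionOver, mem_graph_maximalOperator]
  ext χ
  rw [toDist_toL2]
  change toDist d (toL2 d f) (SchwartzMap.smulLeftCLM ℂ _ χ) = _
  rw [smulLeftCLM_coord_div, toDist_toL2, map_smul, map_smul, LinearMap.smul_apply,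
    pairing_positionEnd]

/-- Multiplication by xⱼ is symmetric; the sign comes from conjugating the imaginary factor (iħ)⁻¹.
-/
theorem inner_of_mem_positionOver_graph (j : Fin d) {f : 𝓢(Space d, ℂ)} (hf : IsRealValued f)
    {φ ψ : L2 d} (h : (φ, ψ) ∈ (positionOver d ħ j).graph) :
    inner ℂ (toL2 d f) ψ = -inner ℂ (toL2 d ((Complex.I * ħ)⁻¹ • positionEnd j f)) φ := by
  rw [positionOver, mem_graph_maximalOperator] at h
  rw [map_smul, inner_smul_left, inner_toL2 hf, inner_toL2 (hf.positionEnd j), ← h]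
  change toDist d φ (SchwartzMap.smulLeftCLM ℂ _ f) = _
  rw [smulLeftCLM_coord_div, map_smul]
  simp

/-- The harmonic oscillator on the Schwartz space. -/
def hamiltonianEnd (d : ℕ) (ħ : ℝ) : Module.End ℂ 𝓢(Space d, ℂ) :=
  (1 / 2 : ℂ) • ∑ j, (positionEnd j * positionEnd j - ((ħ : ℂ) ^ 2) • (derivEnd j * derivEnd j))

theorem laplacian_add_smulLeftCLM (ħ : ℝ) (f : 𝓢(Space d, ℂ)) :
    (1 / 2 : ℂ) • (-((ħ : ℂ) ^ 2 • Δ f) +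
      SchwartzMap.smulLeftCLM ℂ (fun x : Space d => ((‖x‖ ^ 2 : ℝ) : ℂ)) f) =
      hamiltonianEnd d ħ f := by
  have h1 : SchwartzMap.smulLeftCLM ℂ (fun x : Space d => ((‖x‖ ^ 2 : ℝ) : ℂ)) f =
      ∑ j, positionEnd j (positionEnd j f) := by
    ext x
    have : Function.HasTemperateGrowth (fun x : Space d => ((‖x‖ ^ 2 : ℝ) : ℂ)) :=
      Complex.ofRealCLM.hasTemperateGrowth.comp (Function.hasTemperateGrowth_norm_sq _)
    rw [SchwartzMap.smulLeftCLM_apply_apply this, sum_apply, EuclideanSpace.norm_sq_eq]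
    simp only [positionEnd_apply, Real.norm_eq_abs, sq_abs, smul_eq_mul, Complex.ofReal_sum,
      Finset.sum_mul]
    refine Finset.sum_congr rfl fun j _ => ?_
    push_cast
    ring
  have h2 : Δ f = ∑ j, derivEnd j (derivEnd j f) := by
    rw [SchwartzMap.laplacian_eq_sum (EuclideanSpace.basisFun (Fin d) ℝ)]
    simp only [EuclideanSpace.basisFun_apply]
    rfl
  rw [h1, h2, hamiltonianEnd, LinearMap.smul_apply, LinearMap.sum_apply]
  simp only [LinearMap.sub_apply, LinearMap.smul_apply, Module.End.mul_apply,
    Finset.sum_sub_distrib, ← Finset.smul_sum]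
  module

theorem mem_hamiltonian_graph (φ ψ : L2 d) :
    (φ, ψ) ∈ (hamiltonian d ħ).graph ↔
      ∀ χ, toDist d φ (hamiltonianEnd d ħ χ) = toDist d ψ χ := by
  rw [hamiltonian, mem_graph_maximalOperator]
  have h : ∀ χ : 𝓢(Space d, ℂ), (((1 / 2 : ℂ) •
      (-((ħ : ℂ) ^ 2 • LineDeriv.laplacianCLM ℂ (Space d) 𝓢'(Space d, ℂ)) +
        TemperedDistribution.smulLeftCLM ℂ (fun x : Space d => ((‖x‖ ^ 2 : ℝ) : ℂ))))
        (toDist d φ)) χ = toDist d φ (hamiltonianEnd d ħ χ) := by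
    intro χ
    rw [← laplacian_add_smulLeftCLM, map_smul, map_add, map_neg, map_smul,
      ← TemperedDistribution.laplacian_apply_apply, ← TemperedDistribution.laplacianCLM_apply,
      ← TemperedDistribution.smulLeftCLM_apply_apply]
    rfl
  constructor
  · intro hD χ
    rw [← h, hD]
  · intro hD
    ext χ
    rw [h, hD]

theorem pairing_hamiltonianEnd (f g : 𝓢(Space d, ℂ)) :
    pairing d (hamiltonianEnd d ħ f) g = pairing d f (hamiltonianEnd d ħ g) := by
  simp only [hamiltonianEnd, LinearMap.smul_apply, LinearMap.sum_apply, map_smul, map_sum,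
    LinearMap.sub_apply, map_sub, Module.End.mul_apply, pairing_positionEnd, pairing_derivEnd,
    neg_neg]

theorem hamiltonianEnd_eq_ladder (hħ : 0 < ħ) (f : 𝓢(Space d, ℂ)) :
    hamiltonianEnd d ħ f =
      ∑ j, (ħ : ℂ) • (creation ħ j (annihilation ħ j f) + (1 / 2 : ℂ) • f) := by
  rw [hamiltonianEnd, LinearMap.smul_apply, LinearMap.sum_apply, Finset.smul_sum]
  refine Finset.sum_congr rfl fun j _ => ?_
  simp only [LinearMap.sub_apply, LinearMap.smul_apply, Module.End.mul_apply, creation_apply,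
    annihilation_apply, map_smul, map_add, derivEnd_positionEnd, if_true]
  linear_combination (norm := module) (-(1 / 2 : ℂ) • ladderScale_mul_self hħ) •
    (positionEnd j (positionEnd j f) - (ħ : ℂ) ^ 2 • derivEnd j (derivEnd j f) - (ħ : ℂ) • f)

/-- The energy `ħ (|n| + d/2)` of the Hermite function with multi-index `n`. -/
def energy (ħ : ℝ) (n : Fin d → ℕ) : ℝ := ħ * ((∑ j, n j : ℕ) + d / 2)

theorem hamiltonianEnd_hermite (hħ : 0 < ħ) (n : Fin d → ℕ) :
    hamiltonianEnd d ħ (hermite hħ n) = (energy ħ n : ℂ) • hermite hħ n := by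
  have h : ∀ j, creation ħ j (annihilation ħ j (hermite hħ n)) = (n j : ℂ) • hermite hħ n := by
    intro j
    rw [hermite, map_smul, map_smul, smul_comm]
    congr 1
    exact creation_annihilation_excitation (annihilation_creation hħ) (annihilation_groundState hħ)
      j n
  rw [hamiltonianEnd_eq_ladder hħ]
  simp only [h, ← add_smul, smul_smul, ← Finset.sum_smul, energy]
  congr 1
  push_cast
  rw [← Finset.mul_sum, Finset.sum_add_distrib]
  simp [div_eq_mul_inv]

theorem hamiltonian_graph_hermite (hħ : 0 < ħ) (n : Fin d → ℕ) :
    (hermiteBasis d hħ n, (energy ħ n : ℂ) • hermiteBasis d hħ n) ∈ (hamiltonian d ħ).graph := by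
  rw [mem_hamiltonian_graph]
  intro χ
  rw [hermiteBasis_apply, ← map_smul, ← hamiltonianEnd_hermite, toDist_toL2, toDist_toL2,
    pairing_hamiltonianEnd]

theorem inner_hermite_of_mem_hamiltonian_graph (hħ : 0 < ħ) (n : Fin d → ℕ) (φ ψ : L2 d)
    (h : (φ, ψ) ∈ (hamiltonian d ħ).graph) :
    inner ℂ (hermiteBasis d hħ n) ψ = (energy ħ n : ℂ) * inner ℂ (hermiteBasis d hħ n) φ := by
  rw [mem_hamiltonian_graph] at h
  rw [hermiteBasis_apply, inner_toL2 (isRealValued_hermite hħ n),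
    inner_toL2 (isRealValued_hermite hħ n), ← h, hamiltonianEnd_hermite, map_smul, smul_eq_mul]

end Graphs

end Thermal

end

noncomputable section

namespace Thermal

open InnerProductSpace

/-! ### Summability over multi-indices -/

section Summability

variable {d : ℕ}

theorem summable_exp_neg_mul_sum (d : ℕ) {c : ℝ} (hc : 0 < c) :
    Summable fun n : Fin d → ℕ => Real.exp (-c * (∑ j, n j : ℕ)) := by
  induction d with
  | zero => exact Summable.of_finite
  | succ d ih =>
    have h1 : Summable fun k : ℕ => Real.exp (-c * k) := by
      simpa [mul_comm] using Real.summable_exp_nat_mul_iff.mpr (neg_lt_zero.mpr hc)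
    rw [← (Fin.consEquiv fun _ : Fin (d + 1) => ℕ).summable_iff]
    refine (h1.mul_of_nonneg ih (fun _ => (Real.exp_pos _).le) fun _ => (Real.exp_pos _).le).congr
      fun p => ?_
    rw [← Real.exp_add, ← mul_add]
    simp [Fin.consEquiv, Fin.sum_univ_succ]

theorem summable_add_one_mul_exp_neg_mul_sum (d : ℕ) {c : ℝ} (hc : 0 < c) :
    Summable fun n : Fin d → ℕ =>
      (((∑ j, n j : ℕ) : ℝ) + 1) * Real.exp (-c * (∑ j, n j : ℕ)) := by
  -- Half of the decay rate absorbs the linear factor: x + 1 ≤ (2/c + 1) e^{cx/2}.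
  refine Summable.of_nonneg_of_le (fun n => by positivity) (fun n => ?_)
    ((summable_exp_neg_mul_sum d (half_pos hc)).mul_left (2 / c + 1))
  set x : ℝ := ((∑ j, n j : ℕ) : ℝ)
  have hx : 0 ≤ x := Nat.cast_nonneg _
  have h1 : c / 2 * x + 1 ≤ Real.exp (c / 2 * x) := Real.add_one_le_exp _
  have h2 : x + 1 ≤ (2 / c + 1) * Real.exp (c / 2 * x) := by
    have h3 : x ≤ 2 / c * Real.exp (c / 2 * x) := by
      rw [div_mul_eq_mul_div, le_div_iff₀ hc]
      linarith
    have h4 : 1 ≤ Real.exp (c / 2 * x) := Real.one_le_exp (by positivity)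
    linarith
  calc (x + 1) * Real.exp (-c * x)
      ≤ (2 / c + 1) * Real.exp (c / 2 * x) * Real.exp (-c * x) := by gcongr
    _ = (2 / c + 1) * Real.exp (-(c / 2) * x) := by
        rw [mul_assoc, ← Real.exp_add]
        congr 2
        ring

end Summability

/-! ### Matrix coefficients of diagonal operators and their commutators -/

section Coefficients

variable {𝓗 : Type*} [NormedAddCommGroup 𝓗] [InnerProductSpace ℂ 𝓗] {ι : Type*}

theorem inner_diagonal_apply (b : HilbertBasis ι ℂ 𝓗) {t : ι → ℂ} {T : 𝓗 →L[ℂ] 𝓗}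
    (hT : HasSum (fun n => t n • rankOne ℂ (b n) (b n)) T) (m : ι) (φ : 𝓗) :
    inner ℂ (b m) (T φ) = t m * inner ℂ (b m) φ := by
  have h := (hT.mapL (ContinuousLinearMap.apply ℂ 𝓗 φ)).mapL (innerSL ℂ (b m))
  simp only [ContinuousLinearMap.apply_apply, smul_apply, rankOne_apply, innerSL_apply_apply,
    inner_smul_right] at h
  have h' := h.unique (hasSum_single m fun n hn => by
    rw [b.orthonormal.2 (Ne.symm hn), mul_zero, mul_zero])
  rw [h', inner_self_eq_norm_sq_to_K, b.orthonormal.1]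
  simp

/-- Formally, A is moved onto b m by skewness in ⟨b m, (AT - TA)φ⟩. In the sum of the series for ⟨b
m, Kφ⟩ and ⟨Dh m, Tφ⟩, skewness cancels the terms with ⟨b m, Dh n⟩, and orthonormality leaves only n
= m. -/
theorem inner_commutator_apply (b : HilbertBasis ι ℂ 𝓗) {Dh : ι → 𝓗}
    (hskew : ∀ m n, inner ℂ (b m) (Dh n) = -inner ℂ (Dh m) (b n)) {t : ι → ℂ} {T K : 𝓗 →L[ℂ] 𝓗}
    (hT : HasSum (fun n => t n • rankOne ℂ (b n) (b n)) T)
    (hK : HasSum (fun n => t n • (rankOne ℂ (Dh n) (b n) + rankOne ℂ (b n) (Dh n))) K)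
    (m : ι) (φ : 𝓗) :
    inner ℂ (b m) (K φ) = t m * inner ℂ (Dh m) φ - inner ℂ (Dh m) (T φ) := by
  have h1 := (hT.mapL (ContinuousLinearMap.apply ℂ 𝓗 φ)).mapL (innerSL ℂ (Dh m))
  have h2 := (hK.mapL (ContinuousLinearMap.apply ℂ 𝓗 φ)).mapL (innerSL ℂ (b m))
  simp only [ContinuousLinearMap.apply_apply, smul_apply, add_apply, rankOne_apply,
    innerSL_apply_apply, inner_smul_right, inner_add_right] at h1 h2
  rw [eq_sub_iff_add_eq]
  have h := (h2.add h1).unique (hasSum_single m fun n hn => by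
    rw [hskew, b.orthonormal.2 (Ne.symm hn)]
    ring)
  rw [h, hskew, inner_self_eq_norm_sq_to_K, b.orthonormal.1]
  simp
  ring

end Coefficients

section Commutators

variable {𝓗 : Type*} [NormedAddCommGroup 𝓗] [InnerProductSpace ℂ 𝓗]

theorem IsCommutator.smul {A : 𝓗 →ₗ.[ℂ] 𝓗} {T K : 𝓗 →L[ℂ] 𝓗} (h : IsCommutator A T K) (c : ℂ) :
    IsCommutator A (c • T) (c • K) := by
  intro φ
  obtain ⟨h1, h2⟩ := h φ
  refine ⟨A.domain.smul_mem c h1, ?_⟩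
  have : (⟨(c • T) φ, A.domain.smul_mem c h1⟩ : A.domain) = c • ⟨T φ, h1⟩ := rfl
  rw [this, A.map_smul, smul_apply, smul_apply, h2, smul_sub]

theorem IsQuantumGradient.smul {d : ℕ} {ħ : ℝ} {T : L2 d →L[ℂ] L2 d} {K : L2 d →L[ℂ] GradL2 d}
    (h : IsQuantumGradient ħ T K) (c : ℂ) : IsQuantumGradient ħ (c • T) (c • K) := by
  refine ⟨fun j => ?_, fun j => ?_⟩
  · rw [ContinuousLinearMap.comp_smul]
    exact (h.1 j).smul c
  · rw [ContinuousLinearMap.comp_smul]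
    exact (h.2 j).smul c

end Commutators

/-! ### The quantum gradient of a function of the harmonic oscillator -/

section Gradient

variable {d : ℕ} {ħ : ℝ}

/-- The derivative `∂ⱼ hₙ` of a Hermite function. -/
def hermiteDeriv (hħ : 0 < ħ) (j : Fin d) (n : Fin d → ℕ) : L2 d :=
  toL2 d (derivEnd j (hermite hħ n))

/-- The function `xⱼ hₙ / (iħ)`. -/
def hermitePosition (hħ : 0 < ħ) (j : Fin d) (n : Fin d → ℕ) : L2 d :=
  toL2 d ((Complex.I * ħ)⁻¹ • positionEnd j (hermite hħ n))

theorem hermiteDeriv_eq (hħ : 0 < ħ) (j : Fin d) (n : Fin d → ℕ) :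
    hermiteDeriv hħ j n = (ladderScale ħ : ℂ) •
      ((Real.sqrt (n j) : ℂ) • hermiteBasis d hħ (n - Pi.single j 1) -
        (Real.sqrt (n j + 1) : ℂ) • hermiteBasis d hħ (n + Pi.single j 1)) := by
  rw [hermiteDeriv, derivEnd_eq_ladder hħ, annihilation_hermite, creation_hermite, map_smul,
    map_sub, map_smul, map_smul, hermiteBasis_apply, hermiteBasis_apply]

theorem hermitePosition_eq (hħ : 0 < ħ) (j : Fin d) (n : Fin d → ℕ) :
    hermitePosition hħ j n = (-Complex.I * ladderScale ħ : ℂ) •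
      ((Real.sqrt (n j) : ℂ) • hermiteBasis d hħ (n - Pi.single j 1) +
        (Real.sqrt (n j + 1) : ℂ) • hermiteBasis d hħ (n + Pi.single j 1)) := by
  rw [hermitePosition, positionEnd_eq_ladder hħ, annihilation_hermite, creation_hermite, smul_smul,
    map_smul, map_add, map_smul, map_smul, hermiteBasis_apply, hermiteBasis_apply]
  congr 1
  have : (ħ : ℂ) ≠ 0 := by exact_mod_cast hħ.ne'
  rw [mul_inv, Complex.inv_I]
  field_simp

theorem sqrt_le_sum_add_one (n : Fin d → ℕ) (j : Fin d) :
    Real.sqrt (n j + 1) ≤ ((∑ j, n j : ℕ) : ℝ) + 1 := by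
  have h1 : Real.sqrt (n j + 1) ≤ n j + 1 := by
    rw [Real.sqrt_le_left (by positivity)]
    have : (0 : ℝ) ≤ n j := Nat.cast_nonneg _
    nlinarith
  have h2 : (n j : ℝ) ≤ ((∑ j, n j : ℕ) : ℝ) := by
    exact_mod_cast Finset.single_le_sum (f := n) (fun _ _ => Nat.zero_le _) (Finset.mem_univ j)
  linarith

theorem norm_sqrt_smul_hermiteBasis_le (hħ : 0 < ħ) (j : Fin d) (n m m' : Fin d → ℕ) :
    ‖(Real.sqrt (n j) : ℂ) • hermiteBasis d hħ m‖ +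
      ‖(Real.sqrt (n j + 1) : ℂ) • hermiteBasis d hħ m'‖ ≤
      2 * (((∑ j, n j : ℕ) : ℝ) + 1) := by
  rw [norm_smul, norm_smul, (hermiteBasis d hħ).orthonormal.1, (hermiteBasis d hħ).orthonormal.1,
    Complex.norm_real, Complex.norm_real, Real.norm_of_nonneg (Real.sqrt_nonneg _),
    Real.norm_of_nonneg (Real.sqrt_nonneg _)]
  have h1 := sqrt_le_sum_add_one n j
  have h2 : Real.sqrt (n j) ≤ Real.sqrt (n j + 1) := Real.sqrt_le_sqrt (by linarith)
  linarith

/-- A crude linear growth, which serves only the norm convergence of the commutator series and does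
not enter the final constant. -/
theorem norm_hermiteDeriv_le (hħ : 0 < ħ) (j : Fin d) (n : Fin d → ℕ) :
    ‖hermiteDeriv hħ j n‖ ≤ ladderScale ħ * (2 * (((∑ j, n j : ℕ) : ℝ) + 1)) := by
  rw [hermiteDeriv_eq, norm_smul, Complex.norm_real, Real.norm_of_nonneg (ladderScale_pos hħ).le]
  exact mul_le_mul_of_nonneg_left
    ((norm_sub_le _ _).trans (norm_sqrt_smul_hermiteBasis_le hħ j n _ _)) (ladderScale_pos hħ).le

theorem norm_hermitePosition_le (hħ : 0 < ħ) (j : Fin d) (n : Fin d → ℕ) :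
    ‖hermitePosition hħ j n‖ ≤ ladderScale ħ * (2 * (((∑ j, n j : ℕ) : ℝ) + 1)) := by
  rw [hermitePosition_eq, norm_smul, norm_mul, norm_neg, Complex.norm_I, one_mul,
    Complex.norm_real, Real.norm_of_nonneg (ladderScale_pos hħ).le]
  exact mul_le_mul_of_nonneg_left
    ((norm_add_le _ _).trans (norm_sqrt_smul_hermiteBasis_le hħ j n _ _)) (ladderScale_pos hħ).le

theorem mul_sum_le_energy (hħ : 0 < ħ) (n : Fin d → ℕ) : ħ * (∑ j, n j : ℕ) ≤ energy ħ n := by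
  rw [energy]
  gcongr
  linarith [show (0 : ℝ) ≤ d / 2 by positivity]

theorem abs_le_exp_neg_mul_sum (hħ : 0 < ħ) {β C : ℝ} (hβ : 0 < β) (hC : 0 ≤ C) {F : ℝ → ℝ}
    (hF : ∀ E, |F E| ≤ C * Real.exp (-β * E)) (n : Fin d → ℕ) :
    |F (energy ħ n)| ≤ C * Real.exp (-(β * ħ) * (∑ j, n j : ℕ)) := by
  refine (hF _).trans ?_
  gcongr ?_ * Real.exp ?_
  nlinarith [mul_sum_le_energy hħ n]

theorem summable_abs_energy (hħ : 0 < ħ) {β C : ℝ} (hβ : 0 < β) (hC : 0 ≤ C) {F : ℝ → ℝ}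
    (hF : ∀ E, |F E| ≤ C * Real.exp (-β * E)) :
    Summable fun n : Fin d → ℕ => |F (energy ħ n)| :=
  Summable.of_nonneg_of_le (fun _ => abs_nonneg _) (abs_le_exp_neg_mul_sum hħ hβ hC hF)
    ((summable_exp_neg_mul_sum d (mul_pos hβ hħ)).mul_left C)

theorem hasSum_functionOf_hamiltonian (hħ : 0 < ħ) {β C : ℝ} (hβ : 0 < β) (hC : 0 ≤ C) {F : ℝ → ℝ}
    (hF : ∀ E, |F E| ≤ C * Real.exp (-β * E)) :
    HasSum (fun n : Fin d → ℕ =>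
      (F (energy ħ n) : ℂ) • rankOne ℂ (hermiteBasis d hħ n) (hermiteBasis d hħ n))
      (functionOf (hamiltonian d ħ) F) :=
  hasSum_functionOf (hamiltonian d ħ) (hermiteBasis d hħ) (energy ħ)
    (hamiltonian_graph_hermite hħ) (inner_hermite_of_mem_hamiltonian_graph hħ) F
    (summable_abs_energy hħ hβ hC hF)

theorem exists_hasSum_commutator (hħ : 0 < ħ) {β C : ℝ} (hβ : 0 < β) (hC : 0 ≤ C) {F : ℝ → ℝ}
    (hF : ∀ E, |F E| ≤ C * Real.exp (-β * E)) {Dh : (Fin d → ℕ) → L2 d}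
    (hD : ∀ n, ‖Dh n‖ ≤ ladderScale ħ * (2 * (((∑ j, n j : ℕ) : ℝ) + 1))) :
    ∃ K, HasSum (fun n : Fin d → ℕ => (F (energy ħ n) : ℂ) •
      (rankOne ℂ (Dh n) (hermiteBasis d hħ n) + rankOne ℂ (hermiteBasis d hħ n) (Dh n))) K := by
  refine ⟨_, Summable.hasSum ?_⟩
  refine Summable.of_norm_bounded
    ((summable_add_one_mul_exp_neg_mul_sum d (mul_pos hβ hħ)).mul_left (C * ladderScale ħ * 4))
    fun n => ?_
  have h1 := abs_le_exp_neg_mul_sum hħ hβ hC hF n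
  have h2 : ‖rankOne ℂ (Dh n) (hermiteBasis d hħ n) + rankOne ℂ (hermiteBasis d hħ n) (Dh n)‖ ≤
      ladderScale ħ * (2 * (((∑ j, n j : ℕ) : ℝ) + 1)) +
        ladderScale ħ * (2 * (((∑ j, n j : ℕ) : ℝ) + 1)) := by
    refine (norm_add_le _ _).trans (add_le_add ?_ ?_) <;>
    · rw [norm_rankOne, (hermiteBasis d hħ).orthonormal.1]
      simpa using hD n
  rw [norm_smul, Complex.norm_real, Real.norm_eq_abs]
  calc _ ≤ _ := mul_le_mul h1 h2 (norm_nonneg _) (by positivity)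
    _ = _ := by ring

theorem inner_hermiteBasis_hermiteDeriv (hħ : 0 < ħ) (j : Fin d) (m n : Fin d → ℕ) :
    inner ℂ (hermiteBasis d hħ m) (hermiteDeriv hħ j n) =
      -inner ℂ (hermiteDeriv hħ j m) (hermiteBasis d hħ n) := by
  rw [hermiteBasis_apply, hermiteBasis_apply]
  exact inner_of_mem_partialDeriv_graph j (isRealValued_hermite hħ m) (partialDeriv_graph j _)

theorem inner_hermiteBasis_hermitePosition (hħ : 0 < ħ) (j : Fin d) (m n : Fin d → ℕ) :
    inner ℂ (hermiteBasis d hħ m) (hermitePosition hħ j n) =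
      -inner ℂ (hermitePosition hħ j m) (hermiteBasis d hħ n) := by
  rw [hermiteBasis_apply, hermiteBasis_apply]
  exact inner_of_mem_positionOver_graph j (isRealValued_hermite hħ m) (positionOver_graph j _)

/-- From 1 - e^{-u} ≤ u, squared; one of the two factors u then absorbs k, through u k e^{-v} ≤ v
e^{-v} ≤ 1. -/
theorem natCast_mul_exp_mul_le {u v : ℝ} (hu : 0 < u) {k : ℕ} (hv : u * k ≤ v) :
    k * (Real.exp (-v) * (1 - Real.exp (-u)) ^ 2) ≤ u := by
  have h1 : (1 - Real.exp (-u)) ^ 2 ≤ u ^ 2 := by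
    have h2 : Real.exp (-u) ≤ 1 := Real.exp_le_one_iff.mpr (by linarith)
    have h3 : -u + 1 ≤ Real.exp (-u) := Real.add_one_le_exp _
    exact pow_le_pow_left₀ (by linarith) (by linarith) 2
  have h4 : u * k * Real.exp (-v) ≤ 1 := by
    have h5 : v + 1 ≤ Real.exp v := Real.add_one_le_exp v
    rw [Real.exp_neg, ← div_eq_mul_inv, div_le_one (Real.exp_pos _)]
    linarith
  calc k * (Real.exp (-v) * (1 - Real.exp (-u)) ^ 2)
      ≤ k * (Real.exp (-v) * u ^ 2) := by gcongr
    _ = (u * k * Real.exp (-v)) * u := by ring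
    _ ≤ 1 * u := by gcongr
    _ = u := one_mul u

/-- Squaring the increment of e^{-βE} factors out e^{-2βE}, so `natCast_mul_exp_mul_le` applies with
u = βħ and v = 2βE. -/
theorem natCast_mul_sq_sub_le (hħ : 0 < ħ) {β C E : ℝ} (hβ : 0 < β) {F : ℝ → ℝ}
    (hdiff : ∀ E, |F E - F (E + ħ)| ≤ C * (Real.exp (-β * E) - Real.exp (-β * (E + ħ))))
    {k : ℕ} (hk : ħ * k ≤ 2 * E) :
    k * (F E - F (E + ħ)) ^ 2 ≤ C ^ 2 * (β * ħ) := by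
  have h1 : (F E - F (E + ħ)) ^ 2 ≤
      (C * (Real.exp (-β * E) - Real.exp (-β * (E + ħ)))) ^ 2 := by
    rw [← sq_abs]
    exact pow_le_pow_left₀ (abs_nonneg _) (hdiff E) 2
  have h2 : (C * (Real.exp (-β * E) - Real.exp (-β * (E + ħ)))) ^ 2 =
      C ^ 2 * (Real.exp (-(2 * β * E)) * (1 - Real.exp (-(β * ħ))) ^ 2) := by
    have e1 : Real.exp (-β * (E + ħ)) = Real.exp (-β * E) * Real.exp (-(β * ħ)) := by
      rw [← Real.exp_add]; congr 1; ring
    have e2 : Real.exp (-(2 * β * E)) = Real.exp (-β * E) ^ 2 := by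
      rw [← Real.exp_nat_mul]; congr 1; push_cast; ring
    rw [e1, e2]
    ring
  calc k * (F E - F (E + ħ)) ^ 2
      ≤ k * (C ^ 2 * (Real.exp (-(2 * β * E)) * (1 - Real.exp (-(β * ħ))) ^ 2)) := by
        rw [← h2]; gcongr
    _ = C ^ 2 * (k * (Real.exp (-(2 * β * E)) * (1 - Real.exp (-(β * ħ))) ^ 2)) := by ring
    _ ≤ C ^ 2 * (β * ħ) := by
        have hv : β * ħ * k ≤ 2 * β * E := by nlinarith
        exact mul_le_mul_of_nonneg_left (natCast_mul_exp_mul_le (mul_pos hβ hħ) hv) (sq_nonneg C)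

theorem energy_add_single (n : Fin d → ℕ) (j : Fin d) :
    energy ħ (n + Pi.single j 1) = energy ħ n + ħ := by
  have : ∑ i, (n + Pi.single j 1 : Fin d → ℕ) i = ∑ i, n i + 1 := by
    simp [Finset.sum_add_distrib]
  rw [energy, energy, this]
  push_cast
  ring

theorem energy_sub_single {n : Fin d → ℕ} {j : Fin d} (h : n j ≠ 0) :
    energy ħ (n - Pi.single j 1) = energy ħ n - ħ := by
  have hle : Pi.single j 1 ≤ n := by
    intro i
    rcases eq_or_ne i j with rfl | h'
    · simpa using Nat.one_le_iff_ne_zero.mpr h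
    · simp [h']
  have := energy_add_single (ħ := ħ) (n - Pi.single j 1) j
  rw [tsub_add_cancel_of_le hle] at this
  rw [this, add_sub_cancel_right]

theorem sum_ladder_weights_le (hħ : 0 < ħ) {β C : ℝ} (hβ : 0 < β) {F : ℝ → ℝ}
    (hdiff : ∀ E, |F E - F (E + ħ)| ≤ C * (Real.exp (-β * E) - Real.exp (-β * (E + ħ))))
    (n : Fin d → ℕ) :
    ∑ j, (((n j : ℝ) + 1) * (F (energy ħ (n + Pi.single j 1)) - F (energy ħ n)) ^ 2 +
      n j * (F (energy ħ (n - Pi.single j 1)) - F (energy ħ n)) ^ 2) ≤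
      ħ * (C ^ 2 * (2 * β)) := by
  have h1 : ∀ j, (((n j : ℝ) + 1) * (F (energy ħ (n + Pi.single j 1)) - F (energy ħ n)) ^ 2 +
      n j * (F (energy ħ (n - Pi.single j 1)) - F (energy ħ n)) ^ 2) =
      ((n j : ℝ) + 1) * (F (energy ħ n) - F (energy ħ n + ħ)) ^ 2 +
      n j * (F (energy ħ n - ħ) - F (energy ħ n - ħ + ħ)) ^ 2 := by
    intro j
    rw [energy_add_single, sub_add_cancel]
    -- If n j = 0 there is no lower level, but the weight n j vanishes as well.
    rcases eq_or_ne (n j) 0 with h | h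
    · rw [h]; push_cast; ring
    · rw [energy_sub_single h]; ring
  simp only [h1]
  rw [Finset.sum_add_distrib, ← Finset.sum_mul, ← Finset.sum_mul, Finset.sum_add_distrib]
  -- The upward weights n j + 1 add up to |n| + d, and 2E = ħ(2|n| + d).
  have h2 : ((∑ j, n j + d : ℕ) : ℝ) * (F (energy ħ n) - F (energy ħ n + ħ)) ^ 2 ≤
      C ^ 2 * (β * ħ) := by
    refine natCast_mul_sq_sub_le hħ hβ hdiff ?_
    rw [energy]
    have : (0 : ℝ) ≤ ħ * (∑ j, n j : ℕ) := by positivity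
    push_cast at this ⊢
    nlinarith
  have h3 : ((∑ j, n j : ℕ) : ℝ) * (F (energy ħ n - ħ) - F (energy ħ n - ħ + ħ)) ^ 2 ≤
      C ^ 2 * (β * ħ) := by
    rcases Nat.eq_zero_or_pos (∑ j, n j) with h0 | h0
    · rw [h0]
      simp only [Nat.cast_zero, zero_mul]
      positivity
    -- Here the base level is E - ħ, and 2(E - ħ) = ħ(2|n| + d - 2) ≥ ħ|n| requires |n| + d ≥ 2;
    -- this holds since |n| ≥ 1 forces d ≥ 1.
    · refine natCast_mul_sq_sub_le hħ hβ hdiff ?_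
      have hd : 1 ≤ d := by
        by_contra hd
        have : d = 0 := by lia
        subst this
        simp at h0
      have hd' : (1 : ℝ) ≤ d := by exact_mod_cast hd
      have h0' : (1 : ℝ) ≤ (∑ j, n j : ℕ) := by exact_mod_cast h0
      rw [energy]
      nlinarith
  push_cast at h2 h3
  simp only [Finset.sum_const, Finset.card_univ, Fintype.card_fin, nsmul_eq_mul, mul_one]
  linarith

/-- The operator with the given components. -/
def gradientOf (Kd Kx : Fin d → (L2 d →L[ℂ] L2 d)) : L2 d →L[ℂ] GradL2 d :=
  (PiLp.continuousLinearEquiv 2 ℂ (fun _ : Fin d ⊕ Fin d => L2 d)).symm.toContinuousLinearMap ∘L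
    ContinuousLinearMap.pi (Sum.elim Kd Kx)

theorem enorm_gradientOf_sq (Kd Kx : Fin d → (L2 d →L[ℂ] L2 d)) (φ : L2 d) :
    ‖gradientOf Kd Kx φ‖ₑ ^ 2 = ∑ j, (‖Kd j φ‖ₑ ^ 2 + ‖Kx j φ‖ₑ ^ 2) := by
  simp only [enorm_sq_eq_ofReal]
  rw [PiLp.norm_sq_eq_of_L2, Fintype.sum_sum_type, ← Finset.sum_add_distrib,
    ENNReal.ofReal_sum_of_nonneg (fun _ _ => by positivity)]
  refine Finset.sum_congr rfl fun j _ => ?_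
  rw [ENNReal.ofReal_add (by positivity) (by positivity)]
  rfl

/-- The two components of the gradient in the direction `j`, in terms of the coefficients of `φ` in
the Hermite basis. -/
theorem enorm_commutators_sq_le (hħ : 0 < ħ) (j : Fin d) {t : (Fin d → ℕ) → ℝ}
    {T Kd Kx : L2 d →L[ℂ] L2 d}
    (hT : HasSum (fun n => (t n : ℂ) • rankOne ℂ (hermiteBasis d hħ n) (hermiteBasis d hħ n)) T)
    (hKd : HasSum (fun n => (t n : ℂ) • (rankOne ℂ (hermiteDeriv hħ j n) (hermiteBasis d hħ n) +
      rankOne ℂ (hermiteBasis d hħ n) (hermiteDeriv hħ j n))) Kd)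
    (hKx : HasSum (fun n => (t n : ℂ) • (rankOne ℂ (hermitePosition hħ j n) (hermiteBasis d hħ n) +
      rankOne ℂ (hermiteBasis d hħ n) (hermitePosition hħ j n))) Kx) (φ : L2 d) :
    ‖Kd φ‖ₑ ^ 2 + ‖Kx φ‖ₑ ^ 2 ≤
      ∑' n, ENNReal.ofReal (ħ⁻¹ * (((n j + 1) * (t (n + Pi.single j 1) - t n) ^ 2 +
        n j * (t (n - Pi.single j 1) - t n) ^ 2) * ‖inner ℂ (hermiteBasis d hħ n) φ‖ ^ 2)) := by
  set b := hermiteBasis d hħ with hb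
  set s := ladderScale ħ with hs
  -- α m and γ m are the contributions of the levels m - eⱼ and m + eⱼ. The two components of the
  -- gradient see them as α - γ and α + γ.
  set α : (Fin d → ℕ) → ℂ := fun m => (Real.sqrt (m j) * (t m - t (m - Pi.single j 1)) : ℝ) *
    inner ℂ (b (m - Pi.single j 1)) φ with hα
  set γ : (Fin d → ℕ) → ℂ := fun m => (Real.sqrt (m j + 1) * (t m - t (m + Pi.single j 1)) : ℝ) *
    inner ℂ (b (m + Pi.single j 1)) φ with hγ
  have hd : ∀ m, inner ℂ (b m) (Kd φ) = s * (α m - γ m) := by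
    intro m
    rw [inner_commutator_apply b (inner_hermiteBasis_hermiteDeriv hħ j) hT hKd, hermiteDeriv_eq]
    simp only [inner_smul_left, inner_sub_left, ← hb, inner_diagonal_apply b hT, hα, hγ,
      Complex.conj_ofReal, ← hs]
    push_cast
    ring
  have hx : ∀ m, inner ℂ (b m) (Kx φ) = Complex.I * s * (α m + γ m) := by
    intro m
    rw [inner_commutator_apply b (inner_hermiteBasis_hermitePosition hħ j) hT hKx,
      hermitePosition_eq]
    simp only [inner_smul_left, inner_add_left, ← hb, inner_diagonal_apply b hT, hα, hγ,
      Complex.conj_ofReal, ← hs, map_mul, map_neg, Complex.conj_I]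
    push_cast
    ring
  have hsum : ∀ m, ‖inner ℂ (b m) (Kd φ)‖ₑ ^ 2 + ‖inner ℂ (b m) (Kx φ)‖ₑ ^ 2 =
      ENNReal.ofReal (ħ⁻¹ * ‖α m‖ ^ 2) + ENNReal.ofReal (ħ⁻¹ * ‖γ m‖ ^ 2) := by
    intro m
    rw [enorm_sq_eq_ofReal, enorm_sq_eq_ofReal, ← ENNReal.ofReal_add (by positivity)
      (by positivity), ← ENNReal.ofReal_add (by positivity) (by positivity), hd, hx]
    congr 1
    -- The cross terms cancel, and the factor 2 of the parallelogram law times 1/(2ħ) is ħ⁻¹.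
    have h1 := parallelogram_law_with_norm ℂ (α m) (γ m)
    have h2 := ladderScale_sq hħ
    rw [norm_mul, norm_mul, norm_mul, Complex.norm_I, Complex.norm_real,
      Real.norm_of_nonneg (ladderScale_pos hħ).le, one_mul, mul_pow, mul_pow, h2, ← mul_add,
      add_comm, h1]
    field_simp
  have hα' : ∑' m, ENNReal.ofReal (ħ⁻¹ * ‖α m‖ ^ 2) =
      ∑' n, ENNReal.ofReal (ħ⁻¹ * ((n j + 1) * (t (n + Pi.single j 1) - t n) ^ 2 *
        ‖inner ℂ (b n) φ‖ ^ 2)) := by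
    -- Reindexing by m = n + eⱼ loses nothing, because the factor √(m j) in α vanishes where m j =
    -- 0.
    rw [← (add_left_injective (Pi.single j 1 : Fin d → ℕ)).tsum_eq]
    · refine tsum_congr fun n => ?_
      simp only [hα, add_tsub_cancel_right, norm_mul, Complex.norm_real, Real.norm_eq_abs, mul_pow,
        sq_abs, Pi.add_apply, Pi.single_eq_same, Nat.cast_add, Nat.cast_one]
      rw [Real.sq_sqrt (by positivity)]
    · intro m hm
      have hmj : m j ≠ 0 := by
        intro h0
        apply hm
        simp [hα, h0]
      refine ⟨m - Pi.single j 1, tsub_add_cancel_of_le ?_⟩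
      intro i
      rcases eq_or_ne i j with rfl | h'
      · simpa using Nat.one_le_iff_ne_zero.mpr hmj
      · simp [h']
  have hγ' : ∑' m, ENNReal.ofReal (ħ⁻¹ * ‖γ m‖ ^ 2) ≤
      ∑' n, ENNReal.ofReal (ħ⁻¹ * (n j * (t (n - Pi.single j 1) - t n) ^ 2 *
        ‖inner ℂ (b n) φ‖ ^ 2)) := by
    -- The substitution n = m + eⱼ misses the indices with n j = 0; dropping them costs nothing in
    -- an upper bound.
    refine le_trans (le_of_eq (tsum_congr fun m => ?_)) (ENNReal.tsum_comp_le_tsum_of_injective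
      (add_left_injective (Pi.single j 1 : Fin d → ℕ)) _)
    simp only [hγ, add_tsub_cancel_right, norm_mul, Complex.norm_real, Real.norm_eq_abs, mul_pow,
      sq_abs, Pi.add_apply, Pi.single_eq_same, Nat.cast_add, Nat.cast_one]
    rw [Real.sq_sqrt (by positivity)]
  calc ‖Kd φ‖ₑ ^ 2 + ‖Kx φ‖ₑ ^ 2
      = ∑' m, ENNReal.ofReal (ħ⁻¹ * ‖α m‖ ^ 2) + ∑' m, ENNReal.ofReal (ħ⁻¹ * ‖γ m‖ ^ 2) := by
        rw [← b.tsum_enorm_inner_sq, ← b.tsum_enorm_inner_sq, ← ENNReal.tsum_add,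
          ← ENNReal.tsum_add]
        exact tsum_congr hsum
    _ ≤ _ := by
        rw [hα']
        refine (add_le_add_right hγ' _).trans (le_of_eq ?_)
        rw [← ENNReal.tsum_add]
        refine tsum_congr fun n => ?_
        rw [← ENNReal.ofReal_add (by positivity) (by positivity)]
        congr 1
        ring

/-- A decreasing function of the harmonic oscillator whose increments are dominated by those of
`C e^{-βE}` has a bounded quantum gradient. -/
theorem exists_isQuantumGradient_functionOf (hħ : 0 < ħ) {β C : ℝ} (hβ : 0 < β) (hC : 0 ≤ C)
    {F : ℝ → ℝ} (hF : ∀ E, |F E| ≤ C * Real.exp (-β * E))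
    (hdiff : ∀ E, |F E - F (E + ħ)| ≤ C * (Real.exp (-β * E) - Real.exp (-β * (E + ħ)))) :
    ∃ K : L2 d →L[ℂ] GradL2 d, IsQuantumGradient ħ (functionOf (hamiltonian d ħ) F) K ∧
      ‖K‖ ≤ C * Real.sqrt (2 * β) := by
  have hT := hasSum_functionOf_hamiltonian (d := d) hħ hβ hC hF
  choose Kd hKd using fun j : Fin d =>
    exists_hasSum_commutator hħ hβ hC hF (norm_hermiteDeriv_le hħ j)
  choose Kx hKx using fun j : Fin d =>
    exists_hasSum_commutator hħ hβ hC hF (norm_hermitePosition_le hħ j)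
  refine ⟨gradientOf Kd Kx, ⟨fun j => ?_, fun j => ?_⟩, ?_⟩
  · refine isCommutator_of_hasSum_rankOne (partialDeriv d j) (isClosed_graph_maximalOperator _)
      (h := hermiteBasis d hħ) (Dh := hermiteDeriv hħ j) (fun n => ?_) (fun n φ ψ h => ?_) hT (hKd j)
    · rw [hermiteBasis_apply]
      exact partialDeriv_graph j _
    · rw [hermiteBasis_apply]
      exact inner_of_mem_partialDeriv_graph j (isRealValued_hermite hħ n) h
  · refine isCommutator_of_hasSum_rankOne (positionOver d ħ j) (isClosed_graph_maximalOperator _)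
      (h := hermiteBasis d hħ) (Dh := hermitePosition hħ j) (fun n => ?_) (fun n φ ψ h => ?_) hT
      (hKx j)
    · rw [hermiteBasis_apply]
      exact positionOver_graph j _
    · rw [hermiteBasis_apply]
      exact inner_of_mem_positionOver_graph j (isRealValued_hermite hħ n) h
  · refine ContinuousLinearMap.opNorm_le_bound _ (by positivity) fun φ => ?_
    have key : ‖gradientOf Kd Kx φ‖ₑ ^ 2 ≤ ENNReal.ofReal (C ^ 2 * (2 * β)) * ‖φ‖ₑ ^ 2 := by
      rw [enorm_gradientOf_sq]
      refine (Finset.sum_le_sum fun j _ =>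
        enorm_commutators_sq_le hħ j hT (hKd j) (hKx j) φ).trans ?_
      -- Summing over j for each fixed n is what keeps the bound independent of d: the total weight
      -- is compared with the energy of n.
      rw [← Summable.tsum_finsetSum fun _ _ => ENNReal.summable,
        ← (hermiteBasis d hħ).tsum_enorm_inner_sq φ, ← ENNReal.tsum_mul_left]
      refine ENNReal.tsum_le_tsum fun n => ?_
      rw [enorm_sq_eq_ofReal, ← ENNReal.ofReal_mul (by positivity),
        ← ENNReal.ofReal_sum_of_nonneg (fun _ _ => by positivity)]
      refine ENNReal.ofReal_le_ofReal ?_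
      rw [← Finset.mul_sum, ← Finset.sum_mul, ← mul_assoc]
      refine mul_le_mul_of_nonneg_right ?_ (by positivity)
      rw [inv_mul_le_iff₀ hħ]
      exact sum_ladder_weights_le hħ hβ hdiff n
    rw [enorm_sq_eq_ofReal, enorm_sq_eq_ofReal, ← ENNReal.ofReal_mul (by positivity),
      ENNReal.ofReal_le_ofReal_iff (by positivity)] at key
    refine (sq_le_sq₀ (norm_nonneg _) (by positivity)).mp ?_
    rw [mul_pow, mul_pow, Real.sq_sqrt (by positivity)]
    exact key

theorem sqrt_two_mul_le (ħ : ℝ) {β : ℝ} (hβ : 0 < β) :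
    Real.sqrt (2 * β) ≤ 2 * max (Real.sqrt β) (β * Real.sqrt ħ) := by
  have h1 : Real.sqrt (2 * β) ≤ 2 * Real.sqrt β := by
    rw [Real.sqrt_mul (by norm_num)]
    gcongr
    rw [Real.sqrt_le_left (by norm_num)]
    norm_num
  exact h1.trans (by gcongr; exact le_max_left _ _)

theorem exists_isQuantumGradient_smul_functionOf (hħ : 0 < ħ) {β C Z : ℝ} (hβ : 0 < β) (hC : 0 ≤ C)
    (hZ : 0 < Z) {F : ℝ → ℝ} (hF : ∀ E, |F E| ≤ C * Real.exp (-β * E))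
    (hdiff : ∀ E, |F E - F (E + ħ)| ≤ C * (Real.exp (-β * E) - Real.exp (-β * (E + ħ)))) :
    ∃ K : L2 d →L[ℂ] GradL2 d,
      IsQuantumGradient ħ ((Z⁻¹ : ℂ) • functionOf (hamiltonian d ħ) F) K ∧
      ‖K‖ ≤ 2 / Z * C * max (Real.sqrt β) (β * Real.sqrt ħ) := by
  obtain ⟨K, h1, h2⟩ := exists_isQuantumGradient_functionOf (d := d) hħ hβ hC hF hdiff
  refine ⟨(Z⁻¹ : ℂ) • K, h1.smul _, ?_⟩
  rw [norm_smul, norm_inv, Complex.norm_real, Real.norm_of_nonneg hZ.le]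
  calc Z⁻¹ * ‖K‖ ≤ Z⁻¹ * (C * (2 * max (Real.sqrt β) (β * Real.sqrt ħ))) := by
        gcongr
        exact h2.trans (mul_le_mul_of_nonneg_left (sqrt_two_mul_le ħ hβ) hC)
    _ = _ := by ring

end Gradient

/-! ### The Boltzmann and Fermi–Dirac weights -/

section States

variable {d : ℕ} {ħ : ℝ}

/-- This also shows that the trace is finite, as an infinite one would be sent to 0 by `toReal`. -/
theorem partitionFunction_pos (d : ℕ) (hħ : 0 < ħ) {β : ℝ} (hβ : 0 < β) :
    0 < partitionFunction d ħ β := by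
  have hF : ∀ E, |Real.exp (-β * E)| ≤ 1 * Real.exp (-β * E) := fun E => by simp
  have hs : Summable fun n : Fin d → ℕ => Real.exp (-β * energy ħ n) := by
    simpa using summable_abs_energy (d := d) hħ hβ zero_le_one hF
  have h := trace_eq_of_hasSum_rankOne (hermiteBasis d hħ)
    (t := fun n => Real.exp (-β * energy ħ n)) (fun n => (Real.exp_pos _).le)
    (hasSum_functionOf_hamiltonian (F := fun E => Real.exp (-β * E)) hħ hβ zero_le_one hF)
  rw [← ENNReal.ofReal_tsum_of_nonneg (fun n => (Real.exp_pos _).le) hs] at h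
  have hpos : 0 < ∑' n : Fin d → ℕ, Real.exp (-β * energy ħ n) :=
    hs.tsum_pos (fun n => (Real.exp_pos _).le) 0 (Real.exp_pos _)
  rw [partitionFunction, gibbs, h, ENNReal.toReal_ofReal hpos.le]
  positivity

theorem abs_exp_sub_exp_le (hħ : 0 < ħ) {β : ℝ} (hβ : 0 < β) (E : ℝ) :
    |Real.exp (-β * E) - Real.exp (-β * (E + ħ))| ≤
      1 * (Real.exp (-β * E) - Real.exp (-β * (E + ħ))) := by
  rw [one_mul, abs_of_nonneg]
  rw [sub_nonneg, Real.exp_le_exp]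
  nlinarith [mul_pos hβ hħ]

theorem abs_fermi_le (β μ E : ℝ) :
    |(1 + Real.exp (β * (E - μ)))⁻¹| ≤ Real.exp (β * μ) * Real.exp (-β * E) := by
  rw [abs_of_nonneg (by positivity), ← Real.exp_add,
    show β * μ + -β * E = -(β * (E - μ)) by ring, Real.exp_neg]
  gcongr
  linarith

/-- With y < z the two exponentials, the left side is (z - y)/((1 + y)(1 + z)) and the right side is
(z - y)/(yz). -/
theorem abs_fermi_sub_fermi_le (hħ : 0 < ħ) {β : ℝ} (hβ : 0 < β) (μ E : ℝ) :
    |(1 + Real.exp (β * (E - μ)))⁻¹ - (1 + Real.exp (β * (E + ħ - μ)))⁻¹| ≤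
      Real.exp (β * μ) * (Real.exp (-β * E) - Real.exp (-β * (E + ħ))) := by
  have e1 : Real.exp (β * μ) * (Real.exp (-β * E) - Real.exp (-β * (E + ħ))) =
      (Real.exp (β * (E - μ)))⁻¹ - (Real.exp (β * (E + ħ - μ)))⁻¹ := by
    rw [mul_sub, ← Real.exp_add, ← Real.exp_add, ← Real.exp_neg, ← Real.exp_neg]
    ring_nf
  have hle : Real.exp (β * (E - μ)) ≤ Real.exp (β * (E + ħ - μ)) := by
    rw [Real.exp_le_exp]
    nlinarith [mul_pos hβ hħ]
  rw [e1]
  set y := Real.exp (β * (E - μ)) with hy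
  set z := Real.exp (β * (E + ħ - μ)) with hz
  have hy0 : 0 < y := Real.exp_pos _
  have hz0 : 0 < z := Real.exp_pos _
  rw [inv_sub_inv (by positivity) (by positivity), inv_sub_inv hy0.ne' hz0.ne',
    add_sub_add_left_eq_sub, abs_of_nonneg (div_nonneg (by linarith) (by positivity))]
  gcongr
  · linarith
  · linarith

end States

end Thermal

end

theorem proposition2p4 (d : ℕ) (ħ β : ℝ) (hħ : 0 < ħ) (hβ : 0 < β) :
    (0 < Thermal.partitionFunction d ħ β ∧
      ∃ K : Thermal.L2 d →L[ℂ] Thermal.GradL2 d,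
        Thermal.IsQuantumGradient ħ (Thermal.boltzmann d ħ β) K ∧
        ‖K‖ ≤ 2 / Thermal.partitionFunction d ħ β * max (Real.sqrt β) (β * Real.sqrt ħ)) ∧
    ∀ (N : ℕ) (_hN : 0 < N) (μ : ℝ),
      ∃ K : Thermal.L2 d →L[ℂ] Thermal.GradL2 d,
        Thermal.IsQuantumGradient ħ (Thermal.fermiDirac d N ħ β μ) K ∧
        ‖K‖ ≤ 2 / Thermal.inverseFugacity d N ħ β μ * max (Real.sqrt β) (β * Real.sqrt ħ) := by
  have hZ := Thermal.partitionFunction_pos d hħ hβ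
  refine ⟨⟨hZ, ?_⟩, fun N hN μ => ?_⟩
  · obtain ⟨K, h1, h2⟩ := Thermal.exists_isQuantumGradient_smul_functionOf (d := d)
      (F := fun E => Real.exp (-β * E)) hħ hβ zero_le_one hZ (fun E => by simp)
      (Thermal.abs_exp_sub_exp_le hħ hβ)
    exact ⟨K, h1, by simpa using h2⟩
  · have hN' : (0 : ℝ) < N := by exact_mod_cast hN
    have hden : 0 < Thermal.density d N ħ := by
      unfold Thermal.density
      positivity
    obtain ⟨K, h1, h2⟩ := Thermal.exists_isQuantumGradient_smul_functionOf (d := d)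
      (F := fun E => (1 + Real.exp (β * (E - μ)))⁻¹) hħ hβ (Real.exp_pos (β * μ)).le hden
      (Thermal.abs_fermi_le β μ) (Thermal.abs_fermi_sub_fermi_le hħ hβ μ)
    refine ⟨K, h1, h2.trans_eq ?_⟩
    -- The constant C = e^{βμ} divided by λ is 1/Z_μ.
    rw [Thermal.inverseFugacity, neg_mul, Real.exp_neg]
    congr 1
    field_simp
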